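/- All graphs are finite, simple, undirected and connected. For a graph $G=(V,E)$ and $u,v\in V$, the m-interval $I_m(u,v)$ is the set of all vertices that lie on induced paths from $u$ to $v$; a set $C\subseteq V$ is m-convex if $I_m(u,v)\subseteq C$ for all $u,v\in C$; an m-halfspace is an m-convex set $H\subseteq V$ whose complement $V\setminus H$ is m-convex. (Algorithms are deterministic programs of a random access machine with addition, truncated subtraction, comparisons and array access, one time unit per elementary operation; a graph on $V=\{0,\dots,n-1\}$ is given by $n$ and its adjacency matrix, a subset of $V$ by its characteristic vector. Polynomial time means time at most $p(n)$ for a fixed polynomial $p$, where $n=|V|$.) Theorem (polynomial-time separation of m-halfspaces). (1) There is a polynomial-time algorithm that, given a connected graph $G=(V,E)$ and two subsets $A,B\subseteq V$, either outputs an m-halfspace $H$ of $G$ with $A\subseteq H$ and $B\subseteq V\setminus H$, or correctly reports that no such $H$ exists. (2) There is a polynomial-time algorithm that, given a connected graph $G=(V,E)$, decides whether $V$ admits a proper bipartition into two m-convex sets, that is, whether there is an m-halfspace $H$ of $G$ with $\varnothing\subsetneq H\subsetneq V$. -/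

import Mathlib

/-! ### Monophonic convexity -/

namespace Monophonic

/-- The m-interval of `u` and `v`: all vertices lying on an induced (chordless) path from
`u` to `v`. -/
def interval {V : Type*} (G : SimpleGraph V) (u v : V) : Set V :=
  {w | ∃ p : G.Walk u v, p.IsPath ∧ p.IsChordless ∧ w ∈ p.support}

/-- A set of vertices is m-convex if it contains the m-interval of any two of its members. -/
def IsConvex {V : Type*} (G : SimpleGraph V) (C : Set V) : Prop :=
  ∀ u ∈ C, ∀ v ∈ C, interval G u v ⊆ C

/-- The m-halfspaces of `G`: the m-convex sets whose complement is m-convex. -/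
def halfspaces {V : Type*} (G : SimpleGraph V) : Set (Set V) :=
  {H | IsConvex G H ∧ IsConvex G Hᶜ}

/-- `H` is an m-halfspace containing `A` whose complement contains `B`. -/
def Separates {V : Type*} (G : SimpleGraph V) (A B H : Set V) : Prop :=
  H ∈ halfspaces G ∧ A ⊆ H ∧ B ⊆ Hᶜ

end Monophonic

/-! ### A random access machine with a step count

The programs are structured programs for a random access machine: finitely many scalar registers
and finitely many unbounded arrays (those named in the program text), all cells holding natural
numbers. The arithmetic is addition and truncated subtraction only (no multiplication), so
charging one time unit for every elementary operation is a measure that is polynomially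
equivalent to the running time of Turing machines. -/

namespace RAM

/-- The memory: register `x` holds `reg x`, and the cell of array `a` with the pair of
indices `i, j` holds `arr a i j`. -/
@[ext]
structure State where
  reg : ℕ → ℕ
  arr : ℕ → ℕ → ℕ → ℕ

/-- Arithmetic expressions: constants, register reads, array reads, sum, truncated difference. -/
inductive Expr where
  | lit (k : ℕ)
  | reg (x : ℕ)
  | read (a : ℕ) (i j : Expr)
  | add (e₁ e₂ : Expr)
  | sub (e₁ e₂ : Expr)

/-- The value of an expression. -/
def Expr.val (s : State) : Expr → ℕ
  | .lit k => k
  | .reg x => s.reg x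
  | .read a i j => s.arr a (i.val s) (j.val s)
  | .add e₁ e₂ => e₁.val s + e₂.val s
  | .sub e₁ e₂ => e₁.val s - e₂.val s

/-- The time to evaluate an expression: one unit for each operation in it. -/
def Expr.cost : Expr → ℕ
  | .lit _ => 1
  | .reg _ => 1
  | .read _ i j => i.cost + j.cost + 1
  | .add e₁ e₂ => e₁.cost + e₂.cost + 1
  | .sub e₁ e₂ => e₁.cost + e₂.cost + 1

/-- Tests: comparisons of expressions and their Boolean combinations. -/
inductive Test where
  | eq (e₁ e₂ : Expr)
  | lt (e₁ e₂ : Expr)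
  | neg (b : Test)
  | conj (b₁ b₂ : Test)
  | disj (b₁ b₂ : Test)

/-- The truth of a test. -/
def Test.holds (s : State) : Test → Prop
  | .eq e₁ e₂ => e₁.val s = e₂.val s
  | .lt e₁ e₂ => e₁.val s < e₂.val s
  | .neg b => ¬ b.holds s
  | .conj b₁ b₂ => b₁.holds s ∧ b₂.holds s
  | .disj b₁ b₂ => b₁.holds s ∨ b₂.holds s

/-- The time to evaluate a test: one unit for each operation in it. -/
def Test.cost : Test → ℕ
  | .eq e₁ e₂ => e₁.cost + e₂.cost + 1
  | .lt e₁ e₂ => e₁.cost + e₂.cost + 1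
  | .neg b => b.cost + 1
  | .conj b₁ b₂ => b₁.cost + b₂.cost + 1
  | .disj b₁ b₂ => b₁.cost + b₂.cost + 1

/-- Programs. `assign x e` writes the value of `e` to register `x`; `store a i j e` writes it to
the cell of array `a` with indices the values of `i` and `j`. -/
inductive Program where
  | skip
  | assign (x : ℕ) (e : Expr)
  | store (a : ℕ) (i j e : Expr)
  | seq (c₁ c₂ : Program)
  | cond (b : Test) (c₁ c₂ : Program)
  | loop (b : Test) (c : Program)

/-- Writing `k` to register `x`. -/
def State.setReg (s : State) (x k : ℕ) : State where
  reg := Function.update s.reg x k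
  arr := s.arr

/-- Writing `k` to the cell `i, j` of array `a`. -/
def State.setArr (s : State) (a i j k : ℕ) : State where
  reg := s.reg
  arr := Function.update s.arr a (Function.update (s.arr a) i (Function.update (s.arr a i) j k))

/-- `Exec c s s' t`: the program `c`, started in the memory `s`, halts after exactly `t` time
units with the memory `s'`. -/
inductive Exec : Program → State → State → ℕ → Prop
  | skip (s : State) : Exec .skip s s 1
  | assign (s : State) (x : ℕ) (e : Expr) :
      Exec (.assign x e) s (s.setReg x (e.val s)) (e.cost + 1)
  | store (s : State) (a : ℕ) (i j e : Expr) :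
      Exec (.store a i j e) s (s.setArr a (i.val s) (j.val s) (e.val s))
        (i.cost + j.cost + e.cost + 1)
  | seq {c₁ c₂ : Program} {s s' s'' : State} {t₁ t₂ : ℕ} :
      Exec c₁ s s' t₁ → Exec c₂ s' s'' t₂ → Exec (.seq c₁ c₂) s s'' (t₁ + t₂)
  | cond_true {b : Test} {c₁ c₂ : Program} {s s' : State} {t : ℕ} :
      b.holds s → Exec c₁ s s' t → Exec (.cond b c₁ c₂) s s' (b.cost + 1 + t)
  | cond_false {b : Test} {c₁ c₂ : Program} {s s' : State} {t : ℕ} :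
      ¬ b.holds s → Exec c₂ s s' t → Exec (.cond b c₁ c₂) s s' (b.cost + 1 + t)
  | loop_true {b : Test} {c : Program} {s s' s'' : State} {t₁ t₂ : ℕ} :
      b.holds s → Exec c s s' t₁ → Exec (.loop b c) s' s'' t₂ →
        Exec (.loop b c) s s'' (b.cost + 1 + t₁ + t₂)
  | loop_false {b : Test} {c : Program} {s : State} :
      ¬ b.holds s → Exec (.loop b c) s s (b.cost + 1)

/-- The machine is deterministic: the final memory and the running time are determined by the
program and the initial memory. -/
theorem Exec.deterministic {c : Program} {s s₁ s₂ : State} {t₁ t₂ : ℕ}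
    (h₁ : Exec c s s₁ t₁) (h₂ : Exec c s s₂ t₂) : s₁ = s₂ ∧ t₁ = t₂ := by
  induction h₁ generalizing s₂ t₂ with
  | skip => cases h₂; exact ⟨rfl, rfl⟩
  | assign => cases h₂; exact ⟨rfl, rfl⟩
  | store => cases h₂; exact ⟨rfl, rfl⟩
  | seq _ _ ih₁ ih₂ =>
    cases h₂ with
    | seq k₁ k₂ =>
      obtain ⟨rfl, rfl⟩ := ih₁ k₁
      obtain ⟨rfl, rfl⟩ := ih₂ k₂
      exact ⟨rfl, rfl⟩
  | cond_true hb _ ih =>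
    cases h₂ with
    | cond_true _ k => obtain ⟨rfl, rfl⟩ := ih k; exact ⟨rfl, rfl⟩
    | cond_false hb' _ => exact absurd hb hb'
  | cond_false hb _ ih =>
    cases h₂ with
    | cond_true hb' _ => exact absurd hb' hb
    | cond_false _ k => obtain ⟨rfl, rfl⟩ := ih k; exact ⟨rfl, rfl⟩
  | loop_true hb _ _ ih₁ ih₂ =>
    cases h₂ with
    | loop_true _ k₁ k₂ =>
      obtain ⟨rfl, rfl⟩ := ih₁ k₁
      obtain ⟨rfl, rfl⟩ := ih₂ k₂
      exact ⟨rfl, rfl⟩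
    | loop_false hb' => exact absurd hb hb'
  | loop_false hb =>
    cases h₂ with
    | loop_true hb' _ _ => exact absurd hb' hb
    | loop_false _ => exact ⟨rfl, rfl⟩

open Classical in
/-- The bit `1` if `p` is true and `0` otherwise. -/
noncomputable def bit (p : Prop) : ℕ := if p then 1 else 0

/-- The initial memory for an input graph on the vertices `0, …, n - 1`: register `0` holds `n`,
array `0` holds the adjacency matrix, everything else is `0`. -/
noncomputable def graphInput {n : ℕ} (G : SimpleGraph (Fin n)) : State where
  reg x := if x = 0 then n else 0
  arr a i j := if a = 0 then bit (∃ u v : Fin n, (u : ℕ) = i ∧ (v : ℕ) = j ∧ G.Adj u v) else 0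

/-- The initial memory for an input graph together with two sets of vertices: as for the graph
alone, and moreover the row `0` of array `1` holds the characteristic vector of `A` and the
row `0` of array `2` that of `B`. -/
noncomputable def graphSetsInput {n : ℕ} (G : SimpleGraph (Fin n)) (A B : Set (Fin n)) : State where
  reg := (graphInput G).reg
  arr a i j :=
    if a = 1 then bit (i = 0 ∧ ∃ v ∈ A, (v : ℕ) = j)
    else if a = 2 then bit (i = 0 ∧ ∃ v ∈ B, (v : ℕ) = j)
    else (graphInput G).arr a i j

/-- The answer "yes": the final memory holds `1` in register `0`. -/
def State.accepts (s : State) : Prop := s.reg 0 = 1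

/-- The answer "no": the final memory holds `0` in register `0`. -/
def State.rejects (s : State) : Prop := s.reg 0 = 0

/-- The final memory `s` outputs the vertex set `H`: the row `0` of array `3` holds the
characteristic vector of `H`. -/
def State.outputs {n : ℕ} (s : State) (H : Set (Fin n)) : Prop :=
  ∀ v : Fin n, s.arr 3 0 v = bit (v ∈ H)

end RAM

/-! ### First-order programs with bounded loops and their translation to the machine -/

namespace RAM

/-! In a connected graph, `H` is an m-halfspace exactly when, on each side, the ends of the edges
between `H` and its complement form a clique (`mem_halfspaces_iff`). If `a b` is a cut edge with `a
∈ H` and `b ∉ H`, every other cut edge therefore runs from the closed neighbourhood of `a` to that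
of `b`. A vertex near `a` but not near `b` must lie in `H`, and symmetrically for `b`.

The clique condition speaks of two cut edges, hence of four vertices, but these facts shrink it to
two literals. An end in `H` that is adjacent to `b` forms a cut edge with `b`, so its own partner
can be dropped; an end in `H` that is not adjacent to `b` is forced, so the end itself can be
dropped. Thus separation with a prescribed cut edge is a 2-SAT instance (`separates_iff`).

Such an instance is solved through the reflexive transitive closure of its implications. It is
solvable iff no literal is equivalent to its complement. If it is, one may add `¬v → v` for each `v`
that does not imply `¬v`; this creates no contradiction, and the set of all `v` with `¬v → v` is
then a solution (`IsClosure.solution`). All ordered pairs of adjacent vertices are tried as `a`,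
`b`. This reaches every nonempty proper halfspace, since a connected graph has an edge across it;
empty `A` or `B` is treated separately.

For the running time, each step redefines a binary relation on the vertices by a fixed first-order
formula, inside loops over the vertices. Such commands compile to the machine, with a polynomial
time bound read off from the syntax (`Cmd.compile_runs`). -/

/-- The program `c` takes the memory `s` to `s'` within `T` time units. -/
def Runs (c : Program) (s s' : State) (T : ℕ) : Prop := ∃ t, Exec c s s' t ∧ t ≤ T

theorem Runs.seq {c₁ c₂ : Program} {s s' s'' : State} {T₁ T₂ : ℕ} (h₁ : Runs c₁ s s' T₁)
    (h₂ : Runs c₂ s' s'' T₂) : Runs (.seq c₁ c₂) s s'' (T₁ + T₂) := by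
  obtain ⟨t₁, h₁, l₁⟩ := h₁
  obtain ⟨t₂, h₂, l₂⟩ := h₂
  exact ⟨_, .seq h₁ h₂, by omega⟩

theorem Runs.mono {c : Program} {s s' : State} {T T' : ℕ} (h : Runs c s s' T) (hT : T ≤ T') :
    Runs c s s' T' := by
  obtain ⟨t, h, l⟩ := h
  exact ⟨t, h, l.trans hT⟩

theorem Runs.assign (s : State) (x : ℕ) (e : Expr) :
    Runs (.assign x e) s (s.setReg x (e.val s)) (e.cost + 1) := ⟨_, .assign s x e, le_rfl⟩

theorem Runs.store (s : State) (a : ℕ) (i j e : Expr) :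
    Runs (.store a i j e) s (s.setArr a (i.val s) (j.val s) (e.val s))
      (i.cost + j.cost + e.cost + 1) := ⟨_, .store s a i j e, le_rfl⟩

theorem Runs.skip (s : State) : Runs .skip s s 1 := ⟨_, .skip s, le_rfl⟩

theorem Runs.cond_true {b : Test} {c₁ c₂ : Program} {s s' : State} {T : ℕ} (hb : b.holds s)
    (h : Runs c₁ s s' T) : Runs (.cond b c₁ c₂) s s' (b.cost + 1 + T) := by
  obtain ⟨t, h, l⟩ := h
  exact ⟨_, .cond_true hb h, by omega⟩

theorem Runs.cond_false {b : Test} {c₁ c₂ : Program} {s s' : State} {T : ℕ} (hb : ¬ b.holds s)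
    (h : Runs c₂ s s' T) : Runs (.cond b c₁ c₂) s s' (b.cost + 1 + T) := by
  obtain ⟨t, h, l⟩ := h
  exact ⟨_, .cond_false hb h, by omega⟩

@[simp] theorem State.setReg_arr (s : State) (x k : ℕ) : (s.setReg x k).arr = s.arr := rfl

@[simp] theorem State.setReg_reg (s : State) (x k y : ℕ) :
    (s.setReg x k).reg y = if y = x then k else s.reg y := by
  simp [State.setReg, Function.update_apply]

@[simp] theorem State.setArr_reg (s : State) (a i j k : ℕ) : (s.setArr a i j k).reg = s.reg := rfl

theorem State.setArr_arr_of_ne (s : State) {a a' : ℕ} (i j k : ℕ) (h : a' ≠ a) :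
    (s.setArr a i j k).arr a' = s.arr a' := by
  simp [State.setArr, h]

theorem State.setArr_arr_self (s : State) (a i j k i' j' : ℕ) :
    (s.setArr a i j k).arr a i' j' = if i' = i ∧ j' = j then k else s.arr a i' j' := by
  by_cases hi : i' = i
  · subst hi
    by_cases hj : j' = j <;> simp [State.setArr, hj]
  · simp [State.setArr, hi]

theorem bit_of_true {p : Prop} (h : p) : bit p = 1 := by simp [bit, h]

theorem bit_of_false {p : Prop} (h : ¬ p) : bit p = 0 := by simp [bit, h]

theorem bit_congr {p q : Prop} (h : p ↔ q) : bit p = bit q := by rw [propext h]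

/-- Run `c` with register `x` holding `0, …, n - 1` in turn, where register `0` holds `n`. -/
def forLoop (x : ℕ) (c : Program) : Program :=
  .seq (.assign x (.lit 0))
    (.loop (.lt (.reg x) (.reg 0)) (.seq c (.assign x (.add (.reg x) (.lit 1)))))

/-- This is the invariant rule for counted loops. `Inv i` describes the memory just before the test
with counter `i`, so the step must re-establish it after the increment. An iteration costs at most
`T + 8`; the constants leave some slack. -/
theorem forLoop_runs {x n T : ℕ} {c : Program} (Inv : ℕ → State → Prop) (s : State)
    (h0 : Inv 0 (s.setReg x 0))
    (hInv : ∀ i s, Inv i s → s.reg 0 = n ∧ s.reg x = i)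
    (step : ∀ i < n, ∀ s, Inv i s →
      ∃ s', Runs c s s' T ∧ s'.reg x = i ∧ Inv (i + 1) (s'.setReg x (i + 1))) :
    ∃ s', Runs (forLoop x c) s s' ((T + 9) * n + 9) ∧ Inv n s' := by
  have key : ∀ d i, i + d = n → ∀ s, Inv i s →
      ∃ s', Runs (.loop (.lt (.reg x) (.reg 0)) (.seq c (.assign x (.add (.reg x) (.lit 1)))))
        s s' ((T + 9) * d + 4) ∧ Inv n s' := by
    intro d
    induction d with
    | zero =>
      rintro i rfl s hs
      have h := hInv _ _ hs
      refine ⟨s, ⟨_, .loop_false ?_, ?_⟩, hs⟩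
      · simp only [Test.holds, Expr.val]
        omega
      · simp [Test.cost, Expr.cost]
    | succ d ih =>
      intro i hi s hs
      have h := hInv _ _ hs
      obtain ⟨s₁, ⟨t₁, r₁, l₁⟩, hx, hs₁⟩ := step i (by omega) s hs
      obtain ⟨s₂, ⟨t₂, r₂, l₂⟩, hs₂⟩ := ih (i + 1) (by omega) _ hs₁
      refine ⟨s₂, ⟨_, .loop_true (t₂ := t₂) ?_ (.seq r₁ (.assign _ _ _)) ?_, ?_⟩, hs₂⟩
      · simp only [Test.holds, Expr.val]
        omega
      · simpa [Expr.val, hx] using r₂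
      · simp only [Test.cost, Expr.cost]
        nlinarith
  obtain ⟨s', hr, hs'⟩ := key n 0 (by omega) _ h0
  exact ⟨s', ((Runs.assign _ _ _).seq hr).mono (by simp [Expr.cost]; omega), hs'⟩

/-! ### First-order formulas and their evaluation by nested loops -/

/-- First-order formulas over eight binary relation symbols. A formula is read at a level `k`:
its free variables are `0, …, k - 1`, and the outermost quantifiers bind the variable `k`. -/
inductive Formula where
  | rel (a : Fin 8) (i j : ℕ)
  | eq (i j : ℕ)
  | neg (φ : Formula)
  | and (φ ψ : Formula)
  | or (φ ψ : Formula)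
  | ex (φ : Formula)

namespace Formula

/-- The free variables at level `k` are below `k`. -/
def Closed : Formula → ℕ → Prop
  | rel _ i j, k => i < k ∧ j < k
  | eq i j, k => i < k ∧ j < k
  | neg φ, k => φ.Closed k
  | and φ ψ, k => φ.Closed k ∧ ψ.Closed k
  | or φ ψ, k => φ.Closed k ∧ ψ.Closed k
  | ex φ, k => φ.Closed (k + 1)

/-- The truth of a formula at level `k` in a structure with the universe `{0, …, n - 1}`. -/
def Holds {n : ℕ} (M : Fin 8 → Fin n → Fin n → Prop) : Formula → ℕ → (ℕ → Fin n) → Prop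
  | rel a i j, _, ρ => M a (ρ i) (ρ j)
  | eq i j, _, ρ => ρ i = ρ j
  | neg φ, k, ρ => ¬ φ.Holds M k ρ
  | and φ ψ, k, ρ => φ.Holds M k ρ ∧ ψ.Holds M k ρ
  | or φ ψ, k, ρ => φ.Holds M k ρ ∨ ψ.Holds M k ρ
  | ex φ, k, ρ => ∃ w, φ.Holds M (k + 1) (Function.update ρ k w)

/-- The program that writes the truth value of a formula to register `1`. The variable `k` lives
in register `2 * k + 2`, and register `2 * k + 3` is used by quantifiers over it. -/
def compile : Formula → ℕ → Program
  | rel a i j, _ => .assign 1 (.read a (.reg (2 * i + 2)) (.reg (2 * j + 2)))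
  | eq i j, _ =>
    .cond (.eq (.reg (2 * i + 2)) (.reg (2 * j + 2))) (.assign 1 (.lit 1)) (.assign 1 (.lit 0))
  | neg φ, k => .seq (φ.compile k) (.assign 1 (.sub (.lit 1) (.reg 1)))
  | and φ ψ, k => .seq (φ.compile k) (.cond (.eq (.reg 1) (.lit 1)) (ψ.compile k) .skip)
  | or φ ψ, k => .seq (φ.compile k) (.cond (.eq (.reg 1) (.lit 1)) .skip (ψ.compile k))
  | ex φ, k =>
    .seq (.assign (2 * k + 3) (.lit 0))
      (.seq (forLoop (2 * k + 2) (.seq (φ.compile (k + 1))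
          (.cond (.eq (.reg 1) (.lit 1)) (.assign (2 * k + 3) (.lit 1)) .skip)))
        (.assign 1 (.reg (2 * k + 3))))

/-- A bound for the running time of the compiled formula. -/
noncomputable def time : Formula → Polynomial ℕ
  | rel _ _ _ => 9
  | eq _ _ => 9
  | neg φ => φ.time + 9
  | and φ ψ => φ.time + ψ.time + 9
  | or φ ψ => φ.time + ψ.time + 9
  | ex φ => (φ.time + 18) * Polynomial.X + 18

end Formula

/-- The memory holds the structure `M` and the values of the variables below `k`. -/
structure Represents {n : ℕ} (M : Fin 8 → Fin n → Fin n → Prop) (k : ℕ) (ρ : ℕ → Fin n)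
    (s : State) : Prop where
  size : s.reg 0 = n
  var : ∀ i < k, s.reg (2 * i + 2) = ρ i
  arr : ∀ (a : Fin 8) (i j : Fin n), s.arr a i j = bit (M a i j)

/-- The registers other than `1` that are in use at level `k` agree. -/
def RegAgree (k : ℕ) (s s' : State) : Prop := ∀ y, y ≠ 1 → y < 2 * k + 2 → s'.reg y = s.reg y

theorem RegAgree.trans {k : ℕ} {s s' s'' : State} (h : RegAgree k s s') (h' : RegAgree k s' s'') :
    RegAgree k s s'' := fun y hy hk => (h' y hy hk).trans (h y hy hk)

theorem RegAgree.mono {k k' : ℕ} {s s' : State} (h : RegAgree k' s s') (hk : k ≤ k') :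
    RegAgree k s s' := fun y hy hk => h y hy (by omega)

theorem RegAgree.setReg {k : ℕ} {s s' : State} {x v : ℕ} (h : RegAgree k s s')
    (hx : x = 1 ∨ 2 * k + 2 ≤ x) : RegAgree k s (s'.setReg x v) := fun y hy hk => by
  rw [State.setReg_reg, if_neg (by omega), h y hy hk]

theorem RegAgree.refl (k : ℕ) (s : State) : RegAgree k s s := fun _ _ _ => rfl

theorem Represents.of_agree {n : ℕ} {M : Fin 8 → Fin n → Fin n → Prop} {k : ℕ} {ρ : ℕ → Fin n}
    {s s' : State} (h : Represents M k ρ s) (hr : RegAgree k s s')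
    (ha : ∀ a : Fin 8, s'.arr a = s.arr a) : Represents M k ρ s' where
  size := by rw [hr 0 (by omega) (by omega), h.size]
  var i hi := by rw [hr _ (by omega) (by omega), h.var i hi]
  arr a i j := by rw [ha, h.arr]

theorem Represents.update {n : ℕ} {M : Fin 8 → Fin n → Fin n → Prop} {k : ℕ} {ρ : ℕ → Fin n}
    {s : State} (h : Represents M k ρ s) {w : Fin n} (hw : s.reg (2 * k + 2) = w) :
    Represents M (k + 1) (Function.update ρ k w) s where
  size := h.size
  var i hi := by
    rcases Nat.lt_succ_iff_lt_or_eq.1 hi with hi | rfl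
    · rw [Function.update_of_ne hi.ne, h.var i hi]
    · rw [Function.update_self, hw]
  arr := h.arr

/-- `RegAgree` is part of the induction because a subformula must not disturb the loop counters and
flags of the quantifiers around it. -/
theorem Formula.compile_runs (φ : Formula) {n : ℕ} (M : Fin 8 → Fin n → Fin n → Prop) :
    ∀ (k : ℕ) (ρ : ℕ → Fin n) (s : State), φ.Closed k → Represents M k ρ s →
      ∃ s', Runs (φ.compile k) s s' (φ.time.eval n) ∧ s'.reg 1 = bit (φ.Holds M k ρ) ∧
        s'.arr = s.arr ∧ RegAgree k s s' := by
  induction φ with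
  | rel a i j =>
    intro k ρ s hφ hs
    refine ⟨_, (Runs.assign _ _ _).mono ?_, ?_, rfl, (RegAgree.refl k s).setReg (.inl rfl)⟩
    · simp [Expr.cost, time]
    · simp [Expr.val, hs.var i hφ.1, hs.var j hφ.2, hs.arr, Holds]
  | eq i j =>
    intro k ρ s hφ hs
    by_cases h : ρ i = ρ j
    · refine ⟨_, (Runs.cond_true ?_ (Runs.assign _ _ _)).mono ?_, ?_, rfl,
        (RegAgree.refl k s).setReg (.inl rfl)⟩
      · simp [Test.holds, Expr.val, hs.var i hφ.1, hs.var j hφ.2, h]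
      · simp [Expr.cost, Test.cost, time]
      · simp [Expr.val, Holds, h, bit]
    · refine ⟨_, (Runs.cond_false ?_ (Runs.assign _ _ _)).mono ?_, ?_, rfl,
        (RegAgree.refl k s).setReg (.inl rfl)⟩
      · simp [Test.holds, Expr.val, hs.var i hφ.1, hs.var j hφ.2, Fin.val_inj, h]
      · simp [Expr.cost, Test.cost, time]
      · simp [Expr.val, Holds, h, bit]
  | neg φ ih =>
    intro k ρ s hφ hs
    obtain ⟨s₁, r₁, h₁, a₁, g₁⟩ := ih k ρ s hφ hs
    refine ⟨_, (r₁.seq (Runs.assign _ _ _)).mono ?_, ?_, a₁, g₁.setReg (.inl rfl)⟩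
    · simp [Expr.cost, time]
    · by_cases h : φ.Holds M k ρ <;> simp [Expr.val, h₁, Holds, bit, h]
  | and φ ψ ihφ ihψ =>
    intro k ρ s hφ hs
    obtain ⟨s₁, r₁, h₁, a₁, g₁⟩ := ihφ k ρ s hφ.1 hs
    by_cases h : φ.Holds M k ρ
    · obtain ⟨s₂, r₂, h₂, a₂, g₂⟩ := ihψ k ρ s₁ hφ.2 (hs.of_agree g₁ fun a => by rw [a₁])
      refine ⟨s₂, (r₁.seq (Runs.cond_true ?_ r₂)).mono ?_, ?_, a₂.trans a₁, g₁.trans g₂⟩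
      · simp [Test.holds, Expr.val, h₁, h, bit]
      · simp [Test.cost, Expr.cost, time]
        omega
      · simp [Holds, h₂, h]
    · refine ⟨s₁, (r₁.seq (Runs.cond_false ?_ (Runs.skip _))).mono ?_, ?_, a₁, g₁⟩
      · simp [Test.holds, Expr.val, h₁, h, bit]
      · simp [Test.cost, Expr.cost, time]
        omega
      · simp [Holds, h₁, h]
  | or φ ψ ihφ ihψ =>
    intro k ρ s hφ hs
    obtain ⟨s₁, r₁, h₁, a₁, g₁⟩ := ihφ k ρ s hφ.1 hs
    by_cases h : φ.Holds M k ρ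
    · refine ⟨s₁, (r₁.seq (Runs.cond_true ?_ (Runs.skip _))).mono ?_, ?_, a₁, g₁⟩
      · simp [Test.holds, Expr.val, h₁, h, bit]
      · simp [Test.cost, Expr.cost, time]
        omega
      · simp [Holds, h₁, h]
    · obtain ⟨s₂, r₂, h₂, a₂, g₂⟩ := ihψ k ρ s₁ hφ.2 (hs.of_agree g₁ fun a => by rw [a₁])
      refine ⟨s₂, (r₁.seq (Runs.cond_false ?_ r₂)).mono ?_, ?_, a₂.trans a₁, g₁.trans g₂⟩
      · simp [Test.holds, Expr.val, h₁, h, bit]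
      · simp [Test.cost, Expr.cost, time]
        omega
      · simp [Holds, h₂, h]
  | ex φ ih =>
    intro k ρ s hφ hs
    obtain ⟨s₁, r₁, a₁, g₁, -, h₁⟩ := forLoop_runs (x := 2 * k + 2) (n := n)
      (T := φ.time.eval n + 6)
      (c := .seq (φ.compile (k + 1))
        (.cond (.eq (.reg 1) (.lit 1)) (.assign (2 * k + 3) (.lit 1)) .skip))
      -- The flag in register `2 * k + 3` records whether a witness has occurred among the values
      -- below `i`.
      (fun i s' => s'.arr = s.arr ∧ RegAgree k s s' ∧ s'.reg (2 * k + 2) = i ∧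
        s'.reg (2 * k + 3) =
          bit (∃ w : Fin n, (w : ℕ) < i ∧ φ.Holds M (k + 1) (Function.update ρ k w)))
      (s.setReg (2 * k + 3) 0)
      ⟨rfl, ((RegAgree.refl k s).setReg (by omega)).setReg (by omega), by simp, by simp [bit]⟩
      (by
        rintro i s' ⟨-, g, h, -⟩
        exact ⟨by rw [g 0 (by omega) (by omega), hs.size], h⟩)
      (by
        rintro i hi s₁ ⟨a₁, g₁, h₁, f₁⟩
        obtain ⟨s₂, r₂, h₂, a₂, g₂⟩ := ih (k + 1) (Function.update ρ k ⟨i, hi⟩) s₁ hφ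
          ((hs.of_agree g₁ fun a => by rw [a₁]).update h₁)
        have e₂ : s₂.reg (2 * k + 2) = i := by rw [g₂ _ (by omega) (by omega), h₁]
        have e₃ : s₂.reg (2 * k + 3) = s₁.reg (2 * k + 3) := g₂ _ (by omega) (by omega)
        have hex : (∃ w : Fin n, (w : ℕ) < i + 1 ∧ φ.Holds M (k + 1) (Function.update ρ k w)) ↔
            (∃ w : Fin n, (w : ℕ) < i ∧ φ.Holds M (k + 1) (Function.update ρ k w)) ∨
              φ.Holds M (k + 1) (Function.update ρ k ⟨i, hi⟩) := by
          constructor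
          · rintro ⟨w, hw, h⟩
            rcases Nat.lt_succ_iff_lt_or_eq.1 hw with hw | rfl
            · exact .inl ⟨w, hw, h⟩
            · exact .inr h
          · rintro (⟨w, hw, h⟩ | h)
            · exact ⟨w, by omega, h⟩
            · exact ⟨⟨i, hi⟩, by simp, h⟩
        have g : RegAgree k s s₂ := g₁.trans (g₂.mono (by omega))
        by_cases h : φ.Holds M (k + 1) (Function.update ρ k ⟨i, hi⟩)
        · refine ⟨_, (r₂.seq (Runs.cond_true ?_ (Runs.assign _ _ _))).mono ?_, ?_, ?_, ?_, ?_, ?_⟩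
          · simp [Test.holds, Expr.val, h₂, h, bit]
          · simp [Test.cost, Expr.cost]
          · simp [e₂]
          · simp [a₂, a₁]
          · exact (g.setReg (by omega)).setReg (by omega)
          · simp
          · rw [bit_of_true (hex.2 (.inr h))]
            simp [Expr.val]
        · refine ⟨_, (r₂.seq (Runs.cond_false ?_ (Runs.skip _))).mono ?_, ?_, ?_, ?_, ?_, ?_⟩
          · simp [Test.holds, Expr.val, h₂, h, bit]
          · simp [Test.cost, Expr.cost]
          · simp [e₂]
          · simp [a₂, a₁]
          · exact g.setReg (by omega)
          · simp
          · rw [bit_congr hex]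
            simp [e₃, f₁, h])
    refine ⟨_, ((Runs.assign _ _ _).seq (r₁.seq (Runs.assign _ _ _))).mono ?_, ?_, ?_, ?_⟩
    · simp [Expr.cost, time]
      nlinarith
    · simp only [Expr.val, State.setReg_reg, if_true, h₁, Holds]
      exact bit_congr ⟨fun ⟨w, _, h⟩ => ⟨w, h⟩, fun ⟨w, h⟩ => ⟨w, w.2, h⟩⟩
    · simp [a₁]
    · exact g₁.setReg (.inl rfl)

/-- Filling the array `b` by a double loop. -/
theorem fill_runs {k b n T : ℕ} {c : Program} (f : ℕ → ℕ → ℕ) (s : State) (hn : s.reg 0 = n)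
    (hc : ∀ i < n, ∀ j < n, ∀ s', RegAgree k s s' → (∀ a ≠ b, s'.arr a = s.arr a) →
      s'.reg (2 * k + 2) = i → s'.reg (2 * k + 4) = j →
      ∃ s'', Runs c s' s'' T ∧ RegAgree (k + 2) s' s'' ∧ (∀ a ≠ b, s''.arr a = s'.arr a) ∧
        ∀ i' j', s''.arr b i' j' = if i' = i ∧ j' = j then f i j else s'.arr b i' j') :
    ∃ s', Runs (forLoop (2 * k + 2) (forLoop (2 * k + 4) c)) s s' (((T + 9) * n + 18) * n + 9) ∧
      RegAgree k s s' ∧ (∀ a ≠ b, s'.arr a = s.arr a) ∧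
        ∀ i < n, ∀ j < n, s'.arr b i j = f i j := by
  obtain ⟨s₁, r₁, g₁, a₁, -, h₁⟩ := forLoop_runs (x := 2 * k + 2) (n := n)
    (T := (T + 9) * n + 9) (c := forLoop (2 * k + 4) c)
    (fun i s' => RegAgree k s s' ∧ (∀ a ≠ b, s'.arr a = s.arr a) ∧ s'.reg (2 * k + 2) = i ∧
      ∀ i' < i, ∀ j < n, s'.arr b i' j = f i' j) s
    ⟨(RegAgree.refl k s).setReg (by omega), fun _ _ => rfl, by simp, by simp⟩
    (by
      rintro i s' ⟨g, -, h, -⟩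
      exact ⟨by rw [g 0 (by omega) (by omega), hn], h⟩)
    (by
      rintro i hi s₁ ⟨g₁, a₁, h₁, f₁⟩
      obtain ⟨s₂, r₂, g₂, a₂, -, f₂, f₃⟩ := forLoop_runs (x := 2 * k + 4) (n := n) (T := T) (c := c)
        (fun j s' => RegAgree (k + 1) s₁ s' ∧ (∀ a ≠ b, s'.arr a = s₁.arr a) ∧
          s'.reg (2 * k + 4) = j ∧ (∀ i' < i, ∀ j' < n, s'.arr b i' j' = f i' j') ∧
            ∀ j' < j, s'.arr b i j' = f i j') s₁
        ⟨(RegAgree.refl (k + 1) s₁).setReg (by omega), fun _ _ => rfl, by simp, by simpa using f₁,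
          by simp⟩
        (by
          rintro j s' ⟨g, -, h, -⟩
          exact ⟨by rw [g 0 (by omega) (by omega), g₁ 0 (by omega) (by omega), hn], h⟩)
        (by
          rintro j hj s₂ ⟨g₂, a₂, h₂, f₂, f₃⟩
          obtain ⟨s₃, r₃, g₃, a₃, f₄⟩ := hc i hi j hj s₂ (g₁.trans (g₂.mono (by omega)))
            (fun a ha => (a₂ a ha).trans (a₁ a ha))
            (by rw [g₂ _ (by omega) (by omega), h₁]) h₂
          refine ⟨s₃, r₃, by rw [g₃ _ (by omega) (by omega), h₂],
            (g₂.trans (g₃.mono (by omega))).setReg (by omega),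
            fun a ha => (a₃ a ha).trans (a₂ a ha), by simp, ?_, ?_⟩
          · intro i' hi' j' hj'
            rw [State.setReg_arr, f₄, if_neg (by omega), f₂ i' hi' j' hj']
          · intro j' hj'
            rw [State.setReg_arr, f₄]
            split_ifs with h
            · rw [h.2]
            · exact f₃ j' (by omega))
      refine ⟨s₂, r₂, by rw [g₂ _ (by omega) (by omega), h₁],
        (g₁.trans (g₂.mono (by omega))).setReg (by omega),
        fun a ha => (a₂ a ha).trans (a₁ a ha), by simp, ?_⟩
      intro i' hi' j hj
      rw [State.setReg_arr]
      rcases Nat.lt_succ_iff_lt_or_eq.1 hi' with hi' | rfl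
      · exact f₂ i' hi' j hj
      · exact f₃ j hj)
  exact ⟨s₁, r₁.mono (by nlinarith), g₁, a₁, h₁⟩

/-! ### Commands that redefine relations, and their compilation -/

/-- Programs over a finite structure: definition of a relation by a formula in the two variables
after the current ones, composition, branching, and a loop over all elements. -/
inductive Cmd where
  | skip
  | set (a : Fin 8) (φ : Formula)
  | seq (c₁ c₂ : Cmd)
  | ite (φ : Formula) (c₁ c₂ : Cmd)
  | all (c : Cmd)

/-- The result of the steps `f 0, …, f (m - 1)`, applied to `x` one after the other. -/
def iter {n : ℕ} {α : Type*} (f : Fin n → α → α) (x : α) : ℕ → α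
  | 0 => x
  | m + 1 => if h : m < n then f ⟨m, h⟩ (iter f x m) else iter f x m

theorem iter_induction {n : ℕ} {α : Type*} {f : Fin n → α → α} {x : α} (I : ℕ → α → Prop)
    (h0 : I 0 x) (hs : ∀ (i : Fin n) y, I i y → I (i + 1) (f i y)) : I n (iter f x n) := by
  have : ∀ m ≤ n, I m (iter f x m) := by
    intro m
    induction m with
    | zero => exact fun _ => h0
    | succ m ih =>
      intro hm
      rw [iter, dif_pos (by omega)]
      exact hs ⟨m, by omega⟩ _ (ih (by omega))
  exact this n le_rfl

namespace Cmd

def Closed : Cmd → ℕ → Prop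
  | skip, _ => True
  | set _ φ, k => φ.Closed (k + 2)
  | seq c₁ c₂, k => c₁.Closed k ∧ c₂.Closed k
  | ite φ c₁ c₂, k => φ.Closed k ∧ c₁.Closed k ∧ c₂.Closed k
  | all c, k => c.Closed (k + 1)

open Classical in
/-- The effect of a command on the structure, for given values of the variables below `k`. -/
noncomputable def run {n : ℕ} :
    Cmd → ℕ → (ℕ → Fin n) → (Fin 8 → Fin n → Fin n → Prop) → Fin 8 → Fin n → Fin n → Prop
  | skip, _, _, M => M
  | set a φ, k, ρ, M => Function.update M a fun i j =>
      φ.Holds M (k + 2) (Function.update (Function.update ρ k i) (k + 1) j)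
  | seq c₁ c₂, k, ρ, M => c₂.run k ρ (c₁.run k ρ M)
  | ite φ c₁ c₂, k, ρ, M => if φ.Holds M k ρ then c₁.run k ρ M else c₂.run k ρ M
  | all c, k, ρ, M => iter (fun i M => c.run (k + 1) (Function.update ρ k i) M) M n

/-- A redefined relation may occur in its own defining formula. Its new values are therefore
collected in array `8`, which no formula can read, and copied only when all are known. -/
def compile : Cmd → ℕ → Program
  | skip, _ => .skip
  | set a φ, k =>
    .seq
      (forLoop (2 * k + 2) (forLoop (2 * k + 4) (.seq (φ.compile (k + 2))
        (.store 8 (.reg (2 * k + 2)) (.reg (2 * k + 4)) (.reg 1)))))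
      (forLoop (2 * k + 2) (forLoop (2 * k + 4)
        (.store a (.reg (2 * k + 2)) (.reg (2 * k + 4))
          (.read 8 (.reg (2 * k + 2)) (.reg (2 * k + 4))))))
  | seq c₁ c₂, k => .seq (c₁.compile k) (c₂.compile k)
  | ite φ c₁ c₂, k =>
    .seq (φ.compile k) (.cond (.eq (.reg 1) (.lit 1)) (c₁.compile k) (c₂.compile k))
  | all c, k => forLoop (2 * k + 2) (c.compile (k + 1))

/-- A bound for the running time of the compiled command. -/
noncomputable def time : Cmd → Polynomial ℕ
  | skip => 1
  | set _ φ => ((φ.time + 13) * Polynomial.X + 18) * Polynomial.X + 9 +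
      ((15 * Polynomial.X + 18) * Polynomial.X + 9)
  | seq c₁ c₂ => c₁.time + c₂.time
  | ite φ c₁ c₂ => φ.time + c₁.time + c₂.time + 4
  | all c => (c.time + 9) * Polynomial.X + 9

theorem compile_runs (c : Cmd) {n : ℕ} :
    ∀ (k : ℕ) (ρ : ℕ → Fin n) (M : Fin 8 → Fin n → Fin n → Prop) (s : State), c.Closed k →
      Represents M k ρ s → ∃ s', Runs (c.compile k) s s' (c.time.eval n) ∧
        Represents (c.run k ρ M) k ρ s' ∧ RegAgree k s s' := by
  induction c with
  | skip => exact fun k ρ M s _ hs => ⟨s, (Runs.skip s).mono (by simp [time]), hs, .refl k s⟩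
  | set a φ =>
    intro k ρ M s hφ hs
    classical
    set N : Fin n → Fin n → Prop := fun i j =>
      φ.Holds M (k + 2) (Function.update (Function.update ρ k i) (k + 1) j) with hN
    -- The value `0` outside the universe is never used: the arrays are filled only at indices below
    -- `n`.
    set f : ℕ → ℕ → ℕ := fun i j => if h : i < n ∧ j < n then bit (N ⟨i, h.1⟩ ⟨j, h.2⟩) else 0
      with hf
    obtain ⟨s₁, r₁, g₁, a₁, f₁⟩ := fill_runs (k := k) (b := 8) (T := φ.time.eval n + 4)
      (c := .seq (φ.compile (k + 2)) (.store 8 (.reg (2 * k + 2)) (.reg (2 * k + 4)) (.reg 1)))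
      f s hs.size (by
        intro i hi j hj s₁ g₁ a₁ h₁ h₂
        obtain ⟨s₂, r₂, e₂, a₂, g₂⟩ := φ.compile_runs M (k + 2)
          (Function.update (Function.update ρ k ⟨i, hi⟩) (k + 1) ⟨j, hj⟩) s₁ hφ
          (((hs.of_agree g₁ fun a => a₁ a (by omega)).update h₁).update h₂)
        refine ⟨_, (r₂.seq (Runs.store _ _ _ _ _)).mono ?_, ?_, ?_, ?_⟩
        · simp [Expr.cost]
        · exact g₂
        · intro a ha
          rw [State.setArr_arr_of_ne _ _ _ _ ha, a₂]
        · intro i' j'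
          rw [State.setArr_arr_self]
          simp only [Expr.val, a₂]
          rw [g₂ _ (by omega) (by omega), g₂ _ (by omega) (by omega), h₁, h₂, e₂]
          simp [hf, hN, hi, hj])
    obtain ⟨s₂, r₂, g₂, a₂, f₂⟩ := fill_runs (k := k) (b := a) (T := 6) (n := n)
      (c := .store a (.reg (2 * k + 2)) (.reg (2 * k + 4))
          (.read 8 (.reg (2 * k + 2)) (.reg (2 * k + 4))))
      f s₁ (by rw [g₁ 0 (by omega) (by omega), hs.size]) (by
        intro i hi j hj s₂ g₂ a₂ h₁ h₂
        refine ⟨_, (Runs.store _ _ _ _ _).mono ?_, ?_, ?_, ?_⟩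
        · simp [Expr.cost]
        · exact .refl _ _
        · intro a' ha
          rw [State.setArr_arr_of_ne _ _ _ _ ha]
        · intro i' j'
          rw [State.setArr_arr_self]
          simp only [Expr.val, h₁, h₂]
          rw [a₂ 8 (by omega), f₁ i hi j hj])
    refine ⟨s₂, (r₁.seq r₂).mono ?_, ⟨?_, ?_, ?_⟩, g₁.trans g₂⟩
    · refine le_of_eq ?_
      simp [time]
    · rw [g₂ 0 (by omega) (by omega), g₁ 0 (by omega) (by omega), hs.size]
    · intro i hi
      rw [g₂ _ (by omega) (by omega), g₁ _ (by omega) (by omega), hs.var i hi]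
    · intro a' i j
      by_cases ha : a' = a
      · subst ha
        simp [f₂ i i.2 j j.2, hf, hN, run]
      · rw [a₂ a' (by simpa [Fin.val_inj] using ha), a₁ a' (by omega), hs.arr, run,
          Function.update_of_ne ha]
  | seq c₁ c₂ ih₁ ih₂ =>
    intro k ρ M s hc hs
    obtain ⟨s₁, r₁, h₁, g₁⟩ := ih₁ k ρ M s hc.1 hs
    obtain ⟨s₂, r₂, h₂, g₂⟩ := ih₂ k ρ _ s₁ hc.2 h₁
    exact ⟨s₂, (r₁.seq r₂).mono (by simp [time]), h₂, g₁.trans g₂⟩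
  | ite φ c₁ c₂ ih₁ ih₂ =>
    intro k ρ M s hc hs
    obtain ⟨s₁, r₁, h₁, a₁, g₁⟩ := φ.compile_runs M k ρ s hc.1 hs
    have hs₁ := hs.of_agree g₁ fun a => by rw [a₁]
    by_cases h : φ.Holds M k ρ
    · obtain ⟨s₂, r₂, h₂, g₂⟩ := ih₁ k ρ M s₁ hc.2.1 hs₁
      refine ⟨s₂, (r₁.seq (Runs.cond_true ?_ r₂)).mono ?_, ?_, g₁.trans g₂⟩
      · simp [Test.holds, Expr.val, h₁, h, bit]
      · simp [Test.cost, Expr.cost, time]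
        omega
      · simpa [run, h] using h₂
    · obtain ⟨s₂, r₂, h₂, g₂⟩ := ih₂ k ρ M s₁ hc.2.2 hs₁
      refine ⟨s₂, (r₁.seq (Runs.cond_false ?_ r₂)).mono ?_, ?_, g₁.trans g₂⟩
      · simp [Test.holds, Expr.val, h₁, h, bit]
      · simp [Test.cost, Expr.cost, time]
        omega
      · simpa [run, h] using h₂
  | all c ih =>
    intro k ρ M s hc hs
    obtain ⟨s₁, r₁, h₁, g₁, -⟩ := forLoop_runs (x := 2 * k + 2) (n := n) (T := c.time.eval n)
      (c := c.compile (k + 1))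
      (fun i s' => Represents (iter (fun i M => c.run (k + 1) (Function.update ρ k i) M) M i) k ρ s'
        ∧ RegAgree k s s' ∧ s'.reg (2 * k + 2) = i) s
      ⟨hs.of_agree ((RegAgree.refl k s).setReg (by omega)) fun _ => rfl,
        (RegAgree.refl k s).setReg (by omega), by simp⟩
      (fun i s' h => ⟨h.1.size, h.2.2⟩)
      (by
        rintro i hi s₁ ⟨hs₁, g₁, h₁⟩
        obtain ⟨s₂, r₂, h₂, g₂⟩ := ih (k + 1) (Function.update ρ k ⟨i, hi⟩) _ s₁ hc
          (hs₁.update h₁)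
        have g : RegAgree k s₁ (s₂.setReg (2 * k + 2) (i + 1)) :=
          (g₂.mono (by omega)).setReg (by omega)
        refine ⟨s₂, r₂, by rw [g₂ _ (by omega) (by omega), h₁], ⟨?_, ?_, ?_⟩, g₁.trans g, by simp⟩
        · rw [g 0 (by omega) (by omega), hs₁.size]
        · intro j hj
          rw [g _ (by omega) (by omega), hs₁.var j hj]
        · intro a j j'
          rw [State.setReg_arr, h₂.arr, iter, dif_pos hi])
    exact ⟨s₁, r₁.mono (by simp [time]), h₁, g₁⟩

end Cmd

end RAM

/-! ### Monophonic halfspaces and cut edges -/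

namespace Monophonic

variable {V : Type*} {G : SimpleGraph V}

open SimpleGraph in
/-- A walk inside a set can be replaced by an induced path inside that set. -/
theorem exists_chordless_path {u v : V} {S : Set V} (p : G.Walk u v)
    (hp : ∀ w ∈ p.support, w ∈ S) :
    ∃ q : G.Walk u v, q.IsPath ∧ q.IsChordless ∧ ∀ w ∈ q.support, w ∈ S := by
  classical
  -- A shortest walk inside `S` is taken; bypassing its repetitions makes it a path without
  -- lengthening it.
  have hex : ∃ k, ∃ q : G.Walk u v, q.length = k ∧ ∀ w ∈ q.support, w ∈ S := ⟨_, p, rfl, hp⟩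
  obtain ⟨q₀, hlen₀, hq₀⟩ := Nat.find_spec hex
  have hmin : ∀ r : G.Walk u v, (∀ w ∈ r.support, w ∈ S) → q₀.length ≤ r.length := fun r hr =>
    hlen₀ ▸ Nat.find_min' hex ⟨r, rfl, hr⟩
  have hq : ∀ w ∈ q₀.bypass.support, w ∈ S :=
    fun w hw => hq₀ w (q₀.support_bypass_subset_support hw)
  have hlen : q₀.bypass.length ≤ q₀.length := q₀.length_bypass_le_length
  have hpath : q₀.bypass.IsPath := q₀.bypass_isPath
  generalize q₀.bypass = q at hq hlen hpath
  -- An edge `x y` could replace the segment `m`, so minimality gives `m` length at most one: `m` is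
  -- that edge itself.
  have key : ∀ {x y : V} (a : G.Walk u x) (m : G.Walk x y) (c : G.Walk y v),
      q = a.append (m.append c) → G.Adj x y → s(x, y) ∈ q.edges := by
    rintro x y a m c rfl hxy
    have hle := hmin (a.append (.cons hxy c)) (by
      intro w hw
      apply hq
      simp only [Walk.mem_support_append_iff, Walk.support_cons, List.mem_cons] at hw ⊢
      rcases hw with h | rfl | h
      · exact .inl h
      · exact .inl a.end_mem_support
      · exact .inr (.inr h))
    simp only [Walk.length_append, Walk.length_cons] at hle hlen
    have hm : m.length ≤ 1 := by omega
    simp only [Walk.edges_append, List.mem_append]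
    refine .inr (.inl ?_)
    match m, hm, hxy with
    | .nil, _, h => exact absurd rfl h.ne
    | .cons _ .nil, _, _ => simp
    | .cons _ (.cons _ _), h, _ => simp at h
  refine ⟨q, hpath, Walk.isChordless_iff_forall_mem_edges.2 fun x y hx hy hxy => ?_, hq⟩
  obtain ⟨a, c, rfl⟩ := Walk.mem_support_iff_exists_append.1 hx
  rcases Walk.mem_support_append_iff _ _ |>.1 hy with h | h
  · obtain ⟨a₁, a₂, rfl⟩ := Walk.mem_support_iff_exists_append.1 h
    rw [Sym2.eq_swap]
    exact key a₁ a₂ c (Walk.append_assoc _ _ _).symm hxy.symm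
  · obtain ⟨c₁, c₂, rfl⟩ := Walk.mem_support_iff_exists_append.1 h
    exact key a c₁ c₂ rfl hxy

/-- The two ends of any two cut edges in an m-convex set with m-convex complement coincide or
are adjacent. -/
theorem IsConvex.adj_of_cut (hG : G.Connected) {H : Set V} (hH : IsConvex G H)
    (hH' : IsConvex G Hᶜ) {u v u' v' : V} (hu : u ∈ H) (hv : v ∈ H) (hu' : u' ∉ H)
    (hv' : v' ∉ H) (huu' : G.Adj u u') (hvv' : G.Adj v v') : u = v ∨ G.Adj u v := by
  by_contra! hne
  obtain ⟨p₀⟩ := hG.preconnected u' v'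
  obtain ⟨p, hp, hpc, -⟩ := exists_chordless_path (S := Set.univ) p₀ (by simp)
  -- Convexity of the complement keeps `p` outside `H`. The detour `u u' … v' v` then yields an
  -- induced path `q` in `Hᶜ ∪ {u, v}`, which convexity of `H` pulls into `H`. Only `u` and `v`
  -- remain for its vertices, so it is a single edge or trivial.
  have hpH : ∀ w ∈ p.support, w ∈ Hᶜ := fun w hw => hH' u' hu' v' hv' ⟨p, hp, hpc, hw⟩
  obtain ⟨q, hq, hqc, hqS⟩ := exists_chordless_path (S := Hᶜ ∪ {u, v})
    (.cons huu' (p.append (.cons hvv'.symm .nil))) (by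
      intro w hw
      simp only [SimpleGraph.Walk.support_cons, List.mem_cons,
        SimpleGraph.Walk.mem_support_append_iff, SimpleGraph.Walk.support_nil,
        List.not_mem_nil, or_false] at hw
      rcases hw with rfl | h | rfl | rfl
      · simp
      · exact .inl (hpH w h)
      · exact .inl hv'
      · simp)
  have hqH : ∀ w ∈ q.support, w ∈ H := fun w hw => hH u hu v hv ⟨q, hq, hqc, hw⟩
  match q, hq, hqS, hqH with
  | .nil, _, _, _ => exact hne.1 rfl
  | .cons (v := x) hux q, hq, hqS, hqH =>
    have hx : x ∈ (SimpleGraph.Walk.cons hux q).support := by simp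
    rcases hqS x hx with h | rfl | rfl
    · exact h (hqH x hx)
    · exact hux.ne rfl
    · exact hne.2 hux

/-- A set of vertices whose boundary is a clique is m-convex. -/
theorem isConvex_of_adj_of_cut {H : Set V}
    (h : ∀ u v u' v', u ∈ H → v ∈ H → u' ∉ H → v' ∉ H → G.Adj u u' → G.Adj v v' →
      u = v ∨ G.Adj u v) : IsConvex G H := by
  classical
  rintro u hu v hv w ⟨p, hp, hpc, hw⟩
  by_contra hwH
  obtain ⟨p₁, p₂, rfl⟩ := SimpleGraph.Walk.mem_support_iff_exists_append.1 hw
  -- The path leaves `H` at `x` before `w` and re-enters it at `y` after `w`. By hypothesis `x` and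
  -- `y` coincide or are adjacent, giving a repeated vertex or a chord.
  obtain ⟨⟨⟨x, x'⟩, hxx'⟩, hd, hx, hx'⟩ := p₁.exists_boundary_dart H hu hwH
  obtain ⟨⟨⟨y', y⟩, hyy'⟩, he, hy', hy⟩ := p₂.exists_boundary_dart Hᶜ hwH (by simpa using hv)
  simp only [Set.mem_compl_iff, not_not] at hx hx' hy hy'
  have hx₁ : x ∈ p₁.support := SimpleGraph.Walk.dart_fst_mem_support_of_mem_darts _ hd
  have hy₂ : y ∈ p₂.support := SimpleGraph.Walk.dart_snd_mem_support_of_mem_darts _ he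
  have hdisj : ∀ z ∈ H, z ∈ p₁.support → z ∉ p₂.support := fun z hz h₁ h₂ =>
    hp.ne_of_mem_support_of_append (by rintro rfl; exact hwH hz) h₁ h₂ rfl
  rcases h x y x' y' hx hy hx' hy' hxx' hyy'.symm with rfl | hxy
  · exact hdisj x hx hx₁ hy₂
  · have hedge := hpc.mem_edges (by simp [hx₁]) (by simp [hy₂]) hxy
    rw [SimpleGraph.Walk.edges_append, List.mem_append] at hedge
    rcases hedge with he | he
    · exact hdisj y hy (p₁.snd_mem_support_of_mem_edges he) hy₂
    · exact hdisj x hx hx₁ (p₂.fst_mem_support_of_mem_edges he)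

/-- Distinct and nonadjacent vertices. -/
def Apart (G : SimpleGraph V) (u v : V) : Prop := u ≠ v ∧ ¬ G.Adj u v

/-- In a connected graph, the m-halfspaces are the sets for which the ends of the cut edges on
either side form cliques. -/
theorem mem_halfspaces_iff (hG : G.Connected) {H : Set V} :
    H ∈ halfspaces G ↔ ∀ u v u' v', u ∈ H → v ∈ H → u' ∉ H → v' ∉ H → G.Adj u u' → G.Adj v v' →
      ¬ Apart G u v ∧ ¬ Apart G u' v' := by
  constructor
  · rintro ⟨h, h'⟩ u v u' v' hu hv hu' hv' e f
    have h₁ := h.adj_of_cut hG h' hu hv hu' hv' e f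
    have h₂ := h'.adj_of_cut hG (by simpa using h) hu' hv' (by simpa using hu) (by simpa using hv)
      e.symm f.symm
    unfold Apart
    tauto
  · intro h
    refine ⟨isConvex_of_adj_of_cut fun u v u' v' hu hv hu' hv' e f => ?_,
      isConvex_of_adj_of_cut fun u v u' v' hu hv hu' hv' e f => ?_⟩
    · have := (h u v u' v' hu hv hu' hv' e f).1
      unfold Apart at this
      tauto
    · have := (h u' v' u v (by simpa using hu') (by simpa using hv') hu hv e.symm f.symm).2
      unfold Apart at this
      tauto

/-- A nonempty proper subset of a connected graph has a cut edge. -/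
theorem exists_cut_edge (hG : G.Connected) {H : Set V} {a b : V} (ha : a ∈ H) (hb : b ∉ H) :
    ∃ u ∈ H, ∃ v, v ∉ H ∧ G.Adj u v := by
  obtain ⟨p⟩ := hG.preconnected a b
  obtain ⟨⟨⟨x, x'⟩, hxx'⟩, -, hx, hx'⟩ := p.exists_boundary_dart H ha hb
  exact ⟨x, hx, x', hx', hxx'⟩

/-! ### Separation with a prescribed cut edge as a system of two-literal clauses -/

/-- The vertices forced to the side of `a` by the cut edge `a b`. -/
def Forced (G : SimpleGraph V) (a b w : V) : Prop :=
  (w = a ∨ G.Adj w a) ∧ ¬ (w = b ∨ G.Adj w b)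

/-- The implications from `u` to `v` on the side of `a` that the cut edge `a b` yields. -/
def Same (G : SimpleGraph V) (a b u v : V) : Prop :=
  (G.Adj u v ∧ ¬ ((u = a ∨ G.Adj u a) ∧ (v = b ∨ G.Adj v b))) ∨
  (G.Adj u b ∧ ∃ w, Forced G a b w ∧ Apart G w u ∧ G.Adj w v) ∨
  (G.Adj v a ∧ ∃ w, Forced G b a w ∧ Apart G w v ∧ G.Adj w u)

/-- The pairs that the cut edge `a b` and the set `B` prevent from being both on the side of `a`. -/
def Clash (G : SimpleGraph V) (B : Set V) (a b u v : V) : Prop :=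
  (Apart G u v ∧ G.Adj u b ∧ G.Adj v b) ∨
  (∃ w x, Forced G b a w ∧ Forced G b a x ∧ Apart G w x ∧ G.Adj w u ∧ G.Adj x v) ∨
  (u = v ∧ (u ∈ B ∨ u = b))

theorem Apart.symm {u v : V} (h : Apart G u v) : Apart G v u :=
  ⟨h.1.symm, fun e => h.2 e.symm⟩

theorem Clash.symm {B : Set V} {a b u v : V} (h : Clash G B a b u v) : Clash G B a b v u := by
  rcases h with ⟨h, h₁, h₂⟩ | ⟨w, x, hw, hx, h, h₁, h₂⟩ | ⟨rfl, h⟩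
  · exact .inl ⟨h.symm, h₂, h₁⟩
  · exact .inr (.inl ⟨x, w, hx, hw, h.symm, h₂, h₁⟩)
  · exact .inr (.inr ⟨rfl, h⟩)

/-- The separating halfspaces with a given cut edge are the solutions of a system of clauses
with two literals each. -/
theorem separates_iff (hG : G.Connected) {A B H : Set V} {a b : V} (hab : G.Adj a b) :
    Separates G A B H ∧ a ∈ H ∧ b ∉ H ↔
      (∀ u v, Same G a b u v → u ∈ H → v ∈ H) ∧
      (∀ u v, Clash G B a b u v → u ∈ H → v ∉ H) ∧
      (∀ u v, Clash G A b a u v → u ∉ H → v ∈ H) := by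
  rw [Separates, mem_halfspaces_iff hG]
  constructor
  · rintro ⟨⟨h, hA, hB⟩, ha, hb⟩
    -- Otherwise `a w` would be a cut edge besides `a b`, whose outer ends `w` and `b` are distinct
    -- and nonadjacent.
    have hF : ∀ w, Forced G a b w → w ∈ H := by
      rintro w ⟨rfl | h₁, h₂⟩
      · exact ha
      · by_contra hw
        have := (h a a w b ha ha hw hb h₁.symm hab).2
        unfold Apart at this
        tauto
    have hF' : ∀ w, Forced G b a w → w ∉ H := by
      rintro w ⟨rfl | h₁, h₂⟩ hw
      · exact hb hw
      · have := (h w a b b hw ha hb hb h₁ hab).1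
        unfold Apart at this
        tauto
    refine ⟨?_, ?_, ?_⟩
    · rintro u v (⟨huv, hn⟩ | ⟨hub, w, hw, hwu, hwv⟩ | ⟨hva, w, hw, hwv, hwu⟩) hu <;>
        by_contra hv
      · have := h u a v b hu ha hv hb huv hab
        unfold Apart at this
        tauto
      · exact (h w u v b (hF w hw) hu hv hb hwv hub).1 hwu
      · exact (h u a w v hu ha (hF' w hw) hv hwu.symm hva.symm).2 hwv
    · rintro u v (⟨h', h₁, h₂⟩ | ⟨w, x, hw, hx, h', h₁, h₂⟩ | ⟨rfl, h'⟩) hu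
      · exact fun hv => (h u v b b hu hv hb hb h₁ h₂).1 h'
      · exact fun hv => (h u v w x hu hv (hF' w hw) (hF' x hx) h₁.symm h₂.symm).2 h'
      · rcases h' with h' | rfl
        · exact hB h'
        · exact hb
    · rintro u v (⟨h', h₁, h₂⟩ | ⟨w, x, hw, hx, h', h₁, h₂⟩ | ⟨rfl, h'⟩) hu
      · by_contra hv
        exact (h a a u v ha ha hu hv h₁.symm h₂.symm).2 h'
      · by_contra hv
        exact (h w x u v (hF w hw) (hF x hx) hu hv h₁ h₂).1 h'
      · rcases h' with h' | rfl
        · exact hA h'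
        · exact ha
  · rintro ⟨hS, hC, hC'⟩
    have ha : a ∈ H := by
      by_contra ha
      exact ha (hC' a a (.inr (.inr ⟨rfl, .inr rfl⟩)) ha)
    have hb : b ∉ H := fun hb => hC b b (.inr (.inr ⟨rfl, .inr rfl⟩)) hb hb
    have hnear : ∀ u u', u ∈ H → u' ∉ H → G.Adj u u' →
        (u = a ∨ G.Adj u a) ∧ (u' = b ∨ G.Adj u' b) := by
      intro u u' hu hu' e
      by_contra hn
      exact hu' (hS u u' (.inl ⟨e, hn⟩) hu)
    refine ⟨⟨fun u v u' v' hu hv hu' hv' e f => ?_, fun u hu => ?_, fun u hu h => ?_⟩, ha, hb⟩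
    · obtain ⟨hua, hub⟩ := hnear u u' hu hu' e
      obtain ⟨hva, hvb⟩ := hnear v v' hv hv' f
      have hneb : ∀ x ∈ H, x ≠ b := by rintro x hx rfl; exact hb hx
      have hnea : ∀ x, x ∉ H → x ≠ a := by rintro x hx rfl; exact hx ha
      constructor
      · intro h
        -- If both ends are adjacent to `b`, they clash directly. If only one is, the other is
        -- forced, and the adjacent one implies the partner of the forced one. If neither is, both
        -- are forced and their partners clash on the other side.
        by_cases h₁ : G.Adj u b <;> by_cases h₂ : G.Adj v b
        · exact hC u v (.inl ⟨h, h₁, h₂⟩) hu hv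
        · exact hu' (hS u u' (.inl ⟨e, fun _ => hv' (hS u v' (.inr (.inl ⟨h₁, v,
            ⟨hva, by have := hneb v hv; tauto⟩, h.symm, f⟩)) hu)⟩) hu)
        · exact hu' (hS v u' (.inr (.inl ⟨h₂, u,
            ⟨hua, by have := hneb u hu; tauto⟩, h, e⟩)) hv)
        · exact hv' (hC' u' v' (.inr (.inl ⟨u, v, ⟨hua, by have := hneb u hu; tauto⟩,
            ⟨hva, by have := hneb v hv; tauto⟩, h, e, f⟩)) hu')
      · intro h
        by_cases h₁ : G.Adj u' a <;> by_cases h₂ : G.Adj v' a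
        · exact hv' (hC' u' v' (.inl ⟨h, h₁, h₂⟩) hu')
        · exact hu' (hS v u' (.inr (.inr ⟨h₁, v',
            ⟨hvb, by have := hnea v' hv'; tauto⟩, h.symm, f.symm⟩)) hv)
        · exact hv' (hS u v' (.inr (.inr ⟨h₂, u',
            ⟨hub, by have := hnea u' hu'; tauto⟩, h, e.symm⟩)) hu)
        · exact hC u v (.inr (.inl ⟨u', v', ⟨hub, by have := hnea u' hu'; tauto⟩,
            ⟨hvb, by have := hnea v' hv'; tauto⟩, h, e.symm, f.symm⟩)) hu hv
    · by_contra h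
      exact h (hC' u u (.inr (.inr ⟨rfl, .inl hu⟩)) h)
    · exact hC u u (.inr (.inr ⟨rfl, .inl hu⟩)) h h

end Monophonic

/-! ### Clauses with two literals -/

namespace TwoSat

variable {α : Type*}

/-- The complement of a literal; `(true, v)` stands for `v` and `(false, v)` for its negation. -/
def compl (p : Bool × α) : Bool × α := (!p.1, p.2)

/-- The literal `p` is true if the variables in `H` are true and the others false. -/
def Sat (H : Set α) (p : Bool × α) : Prop := p.1 = true ↔ p.2 ∈ H

/-- The closure of a preorder under one more pair. -/
def insertEdge (R : Bool × α → Bool × α → Prop) (p q x y : Bool × α) : Prop :=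
  R x y ∨ R x p ∧ R q y

/-- A chain of implications needs the new pair at most once: whatever lies between its first and
last use can be cut out. So one first-order step updates a transitive closure. -/
theorem insertEdge_reflTransGen (r : Bool × α → Bool × α → Prop) (p q : Bool × α) :
    insertEdge (Relation.ReflTransGen r) p q =
      Relation.ReflTransGen fun x y => r x y ∨ x = p ∧ y = q := by
  have hle : ∀ {x y}, Relation.ReflTransGen r x y →
      Relation.ReflTransGen (fun x y => r x y ∨ x = p ∧ y = q) x y :=
    fun h => Relation.ReflTransGen.mono (fun _ _ h => Or.inl h) _ _ h
  ext x y
  constructor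
  · rintro (h | ⟨h₁, h₂⟩)
    · exact hle h
    · exact (hle h₁).trans (.head (.inr ⟨rfl, rfl⟩) (hle h₂))
  · intro h
    induction h with
    | refl => exact .inl .refl
    | tail _ h ih =>
      rcases h with h | ⟨rfl, rfl⟩
      · exact ih.imp (·.tail h) (And.imp_right (·.tail h))
      · exact .inr ⟨ih.elim id And.left, .refl⟩

/-- A preorder on the literals that contains `E` and is compatible with complements. -/
structure IsClosure (E R : Bool × α → Bool × α → Prop) : Prop where
  le : ∀ p q, E p q → R p q
  refl : ∀ p, R p p
  trans : ∀ p q r, R p q → R q r → R p r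
  contra : ∀ p q, R p q → R (compl q) (compl p)

theorem isClosure_reflTransGen {E : Bool × α → Bool × α → Prop}
    (hE : ∀ p q, E p q → E (compl q) (compl p)) : IsClosure E (Relation.ReflTransGen E) where
  le _ _ h := .single h
  refl _ := .refl
  trans _ _ _ := .trans
  contra p q h := by
    induction h with
    | refl => exact .refl
    | tail _ h ih => exact .head (hE _ _ h) ih

/-- No literal is equivalent to its complement. -/
def Consistent (R : Bool × α → Bool × α → Prop) : Prop :=
  ∀ v, ¬ (R (true, v) (false, v) ∧ R (false, v) (true, v))

/-- The implication `¬v → v` is its own contrapositive, so a single insertion preserves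
compatibility with complements. -/
theorem IsClosure.insertEdge {E R : Bool × α → Bool × α → Prop} (h : IsClosure E R) (v : α) :
    IsClosure E (insertEdge R (false, v) (true, v)) where
  le p q hpq := .inl (h.le p q hpq)
  refl p := .inl (h.refl p)
  trans p q r := by
    rintro (h₁ | ⟨h₁, h₂⟩) (h₃ | ⟨h₃, h₄⟩)
    · exact .inl (h.trans _ _ _ h₁ h₃)
    · exact .inr ⟨h.trans _ _ _ h₁ h₃, h₄⟩
    · exact .inr ⟨h₁, h.trans _ _ _ h₂ h₃⟩
    · exact .inr ⟨h₁, h₄⟩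
  contra p q := by
    rintro (h₁ | ⟨h₁, h₂⟩)
    · exact .inl (h.contra _ _ h₁)
    · exact .inr ⟨h.contra _ _ h₂, h.contra _ _ h₁⟩

/-- A new contradictory cycle would have to use `¬v → v` and return from `v` to `¬v` by old
implications, which `hv` excludes. -/
theorem IsClosure.consistent_insertEdge {E R : Bool × α → Bool × α → Prop} (h : IsClosure E R)
    {v : α} (hv : ¬ R (true, v) (false, v)) :
    Consistent (TwoSat.insertEdge R (false, v) (true, v)) ↔ Consistent R := by
  refine ⟨fun hc u hu => hc u ⟨.inl hu.1, .inl hu.2⟩, fun hc u hu => ?_⟩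
  rcases hu with ⟨h₁ | ⟨h₁, h₂⟩, h₃ | ⟨h₃, h₄⟩⟩
  · exact hc u ⟨h₁, h₃⟩
  · exact hv (h.trans _ _ _ h₄ (h.trans _ _ _ h₁ h₃))
  · exact hv (h.trans _ _ _ h₂ (h.trans _ _ _ h₃ h₁))
  · exact hv (h.trans _ _ _ h₄ h₁)

/-- A consistent closure in which every variable is decided yields a solution. -/
theorem IsClosure.solution {E R : Bool × α → Bool × α → Prop} (h : IsClosure E R)
    (hc : Consistent R) (ht : ∀ v, R (true, v) (false, v) ∨ R (false, v) (true, v)) {p q}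
    (hpq : E p q) (hp : Sat {v | R (false, v) (true, v)} p) :
    Sat {v | R (false, v) (true, v)} q := by
  -- A literal is true exactly when its complement implies it. If this holds of `p` and `p → q`,
  -- then `¬q → ¬p → p → q`.
  have key : ∀ p : Bool × α, Sat {v | R (false, v) (true, v)} p ↔ R (compl p) p := by
    rintro ⟨_ | _, v⟩
    · have h₁ := hc v
      have h₂ := ht v
      simp only [Sat, compl, Set.mem_ofPred_eq, Bool.not_false]
      tauto
    · simp [Sat, compl]
  rw [key] at hp ⊢
  have hR := h.le _ _ hpq
  exact h.trans _ _ _ (h.contra _ _ hR) (h.trans _ _ _ hp hR)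

theorem consistent_of_solution {E : Bool × α → Bool × α → Prop} {H : Set α}
    (hH : ∀ p q, E p q → Sat H p → Sat H q) : Consistent (Relation.ReflTransGen E) := by
  have key : ∀ p q, Relation.ReflTransGen E p q → Sat H p → Sat H q := by
    intro p q h hp
    induction h with
    | refl => exact hp
    | tail _ h ih => exact hH _ _ h ih
  rintro v ⟨h₁, h₂⟩
  have h₁ := key _ _ h₁
  have h₂ := key _ _ h₂
  simp only [Sat, true_iff, false_iff, Bool.false_eq_true] at h₁ h₂
  tauto

end TwoSat

/-! ### The algorithm -/

namespace Monophonic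

open RAM

variable {n : ℕ}

/-- The implications between literals that express separation with the cut edge `a b`. -/
def Clause {V : Type*} (G : SimpleGraph V) (A B : Set V) (a b : V) :
    Bool × V → Bool × V → Prop
  | (true, u), (true, v) => Same G a b u v
  | (true, u), (false, v) => Clash G B a b u v
  | (false, u), (true, v) => Clash G A b a u v
  | (false, u), (false, v) => Same G a b v u

theorem Clause.contra {V : Type*} {G : SimpleGraph V} {A B : Set V} {a b : V} :
    ∀ p q, Clause G A B a b p q → Clause G A B a b (TwoSat.compl q) (TwoSat.compl p)
  | (true, _), (true, _), h => h
  | (true, _), (false, _), h => Clash.symm h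
  | (false, _), (true, _), h => Clash.symm h
  | (false, _), (false, _), h => h

theorem separates_iff_clause {V : Type*} {G : SimpleGraph V} (hG : G.Connected) {A B H : Set V}
    {a b : V} (hab : G.Adj a b) : Separates G A B H ∧ a ∈ H ∧ b ∉ H ↔
      ∀ p q, Clause G A B a b p q → TwoSat.Sat H p → TwoSat.Sat H q := by
  rw [separates_iff hG hab]
  constructor
  · rintro ⟨h₁, h₂, h₃⟩ ⟨_ | _, u⟩ ⟨_ | _, v⟩ h <;>
      simp only [TwoSat.Sat, true_iff, false_iff, Bool.false_eq_true] <;> intro hu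
    · exact fun hv => hu (h₁ v u h hv)
    · exact h₃ u v h hu
    · exact h₂ u v h hu
    · exact h₁ u v h hu
  · intro h
    refine ⟨fun u v huv hu => ?_, fun u v huv hu => ?_, fun u v huv hu => ?_⟩
    · simpa [TwoSat.Sat] using h (true, u) (true, v) huv (by simpa [TwoSat.Sat] using hu)
    · simpa [TwoSat.Sat] using h (true, u) (false, v) huv (by simpa [TwoSat.Sat] using hu)
    · simpa [TwoSat.Sat] using h (false, u) (true, v) huv (by simpa [TwoSat.Sat] using hu)

/-! ### Literals inside a structure, and the insertion of an implication -/

/-- The symbols for the relation on literals. -/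
def sym : Bool → Bool → Fin 8
  | true, true => 4
  | true, false => 5
  | false, true => 6
  | false, false => 7

/-- The relation on literals held by the symbols `4` to `7`. -/
def litRel (M : Fin 8 → Fin n → Fin n → Prop) (p q : Bool × Fin n) : Prop :=
  M (sym p.1 q.1) p.2 q.2

/-- Two structures agree in the symbols `0` to `3`. -/
def BaseAgree (M M' : Fin 8 → Fin n → Fin n → Prop) : Prop := ∀ a, a < 4 → M' a = M a

theorem BaseAgree.refl (M : Fin 8 → Fin n → Fin n → Prop) : BaseAgree M M := fun _ _ => rfl

theorem BaseAgree.trans {M M' M'' : Fin 8 → Fin n → Fin n → Prop} (h : BaseAgree M M')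
    (h' : BaseAgree M' M'') : BaseAgree M M'' := fun a ha => (h' a ha).trans (h a ha)

theorem sym_inj : ∀ {s t s' t' : Bool}, sym s t = sym s' t' ↔ s = s' ∧ t = t' := by decide

theorem not_sym_lt : ∀ s t : Bool, ¬ sym s t < 4 := by decide

theorem baseAgree_update (M : Fin 8 → Fin n → Fin n → Prop) (s t : Bool)
    (r : Fin n → Fin n → Prop) : BaseAgree M (Function.update M (sym s t) r) := fun a ha =>
  Function.update_of_ne (by rintro rfl; exact not_sym_lt s t ha) _ _

/-- Apply a command to every pair of signs. -/
def signs (c : Bool → Bool → Cmd) : Cmd :=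
  .seq (c true true) (.seq (c true false) (.seq (c false true) (c false false)))

theorem signs_closed {c : Bool → Bool → Cmd} {k : ℕ} (h : ∀ s t, (c s t).Closed k) :
    (signs c).Closed k := ⟨h _ _, h _ _, h _ _, h _ _⟩

/-- Make the relation on literals the equality. -/
def reset (k : ℕ) : Cmd :=
  signs fun s t => .set (sym s t) (if s = t then .eq k (k + 1) else .neg (.eq k k))

theorem run_reset (k : ℕ) (ρ : ℕ → Fin n) (M : Fin 8 → Fin n → Fin n → Prop) :
    BaseAgree M ((reset k).run k ρ M) ∧ litRel ((reset k).run k ρ M) = Eq := by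
  refine ⟨?_, ?_⟩
  · simp only [reset, signs, Cmd.run]
    exact (((baseAgree_update _ _ _ _).trans (baseAgree_update _ _ _ _)).trans
      (baseAgree_update _ _ _ _)).trans (baseAgree_update _ _ _ _)
  · ext ⟨s, i⟩ ⟨t, j⟩
    cases s <;> cases t <;>
      simp [reset, signs, Cmd.run, litRel, sym_inj, Formula.Holds]

/-- Add the pair of the literals `(s, u)` and `(t, v)` to the preorder on literals. -/
def addEdge (k : ℕ) (s : Bool) (u : ℕ) (t : Bool) (v : ℕ) : Cmd :=
  signs fun s' t' => .set (sym s' t') (.or (.rel (sym s' t') k (k + 1))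
    (.and (.rel (sym s' s) k u) (.rel (sym t t') v (k + 1))))

theorem addEdge_closed {k u v : ℕ} (s t : Bool) (hu : u < k) (hv : v < k) :
    (addEdge k s u t v).Closed k := by
  refine signs_closed fun s' t' => ?_
  simp only [Cmd.Closed, Formula.Closed]
  omega

theorem run_addEdge {k u v : ℕ} (s t : Bool) (hu : u < k) (hv : v < k) (ρ : ℕ → Fin n)
    (M : Fin 8 → Fin n → Fin n → Prop) :
    BaseAgree M ((addEdge k s u t v).run k ρ M) ∧
      litRel ((addEdge k s u t v).run k ρ M) =
        TwoSat.insertEdge (litRel M) (s, ρ u) (t, ρ v) := by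
  refine ⟨?_, ?_⟩
  · simp only [addEdge, signs, Cmd.run]
    exact (((baseAgree_update _ _ _ _).trans (baseAgree_update _ _ _ _)).trans
      (baseAgree_update _ _ _ _)).trans (baseAgree_update _ _ _ _)
  · have h₁ : u ≠ k := by omega
    have h₂ : u ≠ k + 1 := by omega
    have h₃ : v ≠ k := by omega
    have h₄ : v ≠ k + 1 := by omega
    ext ⟨s', i⟩ ⟨t', j⟩
    -- The four symbols are updated in succession, so later updates read earlier results. This is
    -- harmless: the insertion of `p → q` changes neither what implies `p` nor what `q` implies.
    cases s <;> cases t <;> cases s' <;> cases t' <;>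
      simp [addEdge, signs, Cmd.run, litRel, sym_inj, Formula.Holds,
        TwoSat.insertEdge, h₁, h₂, h₃, h₄] <;> tauto

def nearF (i j : ℕ) : Formula := .or (.eq i j) (.rel 0 i j)

def forcedF (a b w : ℕ) : Formula := .and (nearF w a) (.neg (nearF w b))

def apartF (u v : ℕ) : Formula := .and (.neg (.eq u v)) (.neg (.rel 0 u v))

/-! ### Building the implication closure of the clauses -/

/-- The formula for `Same`, at the level `5`. -/
def sameF (a b u v : ℕ) : Formula :=
  .or (.and (.rel 0 u v) (.neg (.and (nearF u a) (nearF v b))))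
    (.or (.and (.rel 0 u b) (.ex (.and (forcedF a b 5) (.and (apartF 5 u) (.rel 0 5 v)))))
      (.and (.rel 0 v a) (.ex (.and (forcedF b a 5) (.and (apartF 5 v) (.rel 0 5 u))))))

/-- The formula for `Clash`, at the level `5`, for the set in row `0` of the symbol `c`. -/
def clashF (c : Fin 8) (a b u v : ℕ) : Formula :=
  .or (.and (apartF u v) (.and (.rel 0 u b) (.rel 0 v b)))
    (.or (.ex (.ex (.and (forcedF b a 5) (.and (forcedF b a 6) (.and (apartF 5 6)
        (.and (.rel 0 5 u) (.rel 0 6 v)))))))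
      (.and (.eq u v) (.or (.rel c 0 u) (.eq u b))))

/-- The formula for `Clause`, at the level `5`. -/
def clauseF : Bool → Bool → Formula
  | true, true => sameF 1 2 3 4
  | true, false => clashF 2 1 2 3 4
  | false, true => clashF 1 2 1 3 4
  | false, false => sameF 1 2 4 3

theorem clauseF_closed (s t : Bool) : (clauseF s t).Closed 5 := by
  cases s <;> cases t <;>
    simp [clauseF, sameF, clashF, forcedF, apartF, nearF, Formula.Closed]

theorem holds_clauseF {G : SimpleGraph (Fin n)} {A B : Set (Fin n)}
    {M : Fin 8 → Fin n → Fin n → Prop} {ρ : ℕ → Fin n} (h₀ : ∀ i j, M 0 i j ↔ G.Adj i j)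
    (h₁ : ∀ j, M 1 (ρ 0) j ↔ j ∈ A) (h₂ : ∀ j, M 2 (ρ 0) j ↔ j ∈ B) (s t : Bool) :
    (clauseF s t).Holds M 5 ρ ↔ Clause G A B (ρ 1) (ρ 2) (s, ρ 3) (t, ρ 4) := by
  cases s <;> cases t <;>
    simp [clauseF, sameF, clashF, forcedF, apartF, nearF, Formula.Holds, Clause, Same, Clash,
      Forced, Apart, h₀, h₁, h₂]

/-- The structure holds the graph `G`, and the sets `A` and `B` in the row of the vertex `z`. -/
structure IsInput (G : SimpleGraph (Fin n)) (A B : Set (Fin n)) (z : Fin n)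
    (M : Fin 8 → Fin n → Fin n → Prop) : Prop where
  adj : ∀ i j, M 0 i j ↔ G.Adj i j
  left : ∀ j, M 1 z j ↔ j ∈ A
  right : ∀ j, M 2 z j ↔ j ∈ B

theorem IsInput.of_agree {G : SimpleGraph (Fin n)} {A B : Set (Fin n)} {z : Fin n}
    {M M' : Fin 8 → Fin n → Fin n → Prop} (h : IsInput G A B z M) (ha : ∀ a, a < 3 → M' a = M a) :
    IsInput G A B z M' where
  adj := by rw [ha 0 (by decide)]; exact h.adj
  left := by rw [ha 1 (by decide)]; exact h.left
  right := by rw [ha 2 (by decide)]; exact h.right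

theorem BaseAgree.isInput {G : SimpleGraph (Fin n)} {A B : Set (Fin n)} {z : Fin n}
    {M M' : Fin 8 → Fin n → Fin n → Prop} (ha : BaseAgree M M') (h : IsInput G A B z M) :
    IsInput G A B z M' :=
  h.of_agree fun a h => ha a (h.trans (by decide))

/-- Add the implication between the literals with the signs `s` and `t` if there is a clause
for it. -/
def addClause (s t : Bool) : Cmd := .ite (clauseF s t) (addEdge 5 s 3 t 4) .skip

/-- Add all clauses. -/
def addClauses : Cmd := .all (.all (signs addClause))

/-- The literals are preordered by the closure of a part of `E` that contains `E ∩ P`. -/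
def Generated (E P : Bool × Fin n → Bool × Fin n → Prop) (M : Fin 8 → Fin n → Fin n → Prop) :
    Prop :=
  ∃ r, litRel M = Relation.ReflTransGen r ∧ (∀ p q, r p q → E p q) ∧ ∀ p q, E p q → P p q → r p q

theorem Generated.mono {E P P' : Bool × Fin n → Bool × Fin n → Prop}
    {M : Fin 8 → Fin n → Fin n → Prop} (h : Generated E P M) (hP : ∀ p q, P' p q → P p q) :
    Generated E P' M := by
  obtain ⟨r, h₁, h₂, h₃⟩ := h
  exact ⟨r, h₁, h₂, fun p q hE hp => h₃ p q hE (hP p q hp)⟩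

/-- Midway through, a clause may be present without its contrapositive. Hence only generation by a
part of the clauses is tracked here; compatibility with complements is recovered once all of them
are in. -/
theorem run_addClause {G : SimpleGraph (Fin n)} {A B : Set (Fin n)} {ρ : ℕ → Fin n}
    {M : Fin 8 → Fin n → Fin n → Prop} {P : Bool × Fin n → Bool × Fin n → Prop}
    (hM : IsInput G A B (ρ 0) M) (h : Generated (Clause G A B (ρ 1) (ρ 2)) P M) (s t : Bool) :
    BaseAgree M ((addClause s t).run 5 ρ M) ∧
      Generated (Clause G A B (ρ 1) (ρ 2)) (fun p q => P p q ∨ p = (s, ρ 3) ∧ q = (t, ρ 4))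
        ((addClause s t).run 5 ρ M) := by
  have hF := holds_clauseF hM.adj hM.left hM.right s t
  obtain ⟨r, h₁, h₂, h₃⟩ := h
  by_cases hc : (clauseF s t).Holds M 5 ρ
  · obtain ⟨hb, hr⟩ := run_addEdge s t (show 3 < 5 by omega) (show 4 < 5 by omega) ρ M
    simp only [addClause, Cmd.run, if_pos hc]
    refine ⟨hb, fun x y => r x y ∨ x = (s, ρ 3) ∧ y = (t, ρ 4), ?_, ?_, ?_⟩
    · rw [hr, h₁, TwoSat.insertEdge_reflTransGen]
    · rintro p q (h | ⟨rfl, rfl⟩)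
      · exact h₂ p q h
      · exact hF.1 hc
    · exact fun p q hE => Or.imp_left (h₃ p q hE)
  · simp only [addClause, Cmd.run, if_neg hc]
    refine ⟨.refl M, r, h₁, h₂, ?_⟩
    rintro p q hE (h | ⟨rfl, rfl⟩)
    · exact h₃ p q hE h
    · exact absurd (hF.2 hE) hc

theorem run_signs_addClause {G : SimpleGraph (Fin n)} {A B : Set (Fin n)} {ρ : ℕ → Fin n}
    {M : Fin 8 → Fin n → Fin n → Prop} {P : Bool × Fin n → Bool × Fin n → Prop}
    (hM : IsInput G A B (ρ 0) M) (h : Generated (Clause G A B (ρ 1) (ρ 2)) P M) :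
    BaseAgree M ((signs addClause).run 5 ρ M) ∧
      Generated (Clause G A B (ρ 1) (ρ 2)) (fun p q => P p q ∨ p.2 = ρ 3 ∧ q.2 = ρ 4)
        ((signs addClause).run 5 ρ M) := by
  simp only [signs, Cmd.run]
  obtain ⟨b₁, g₁⟩ := run_addClause hM h true true
  have hM := b₁.isInput hM
  obtain ⟨b₂, g₂⟩ := run_addClause hM g₁ true false
  have hM := b₂.isInput hM
  obtain ⟨b₃, g₃⟩ := run_addClause hM g₂ false true
  have hM := b₃.isInput hM
  obtain ⟨b₄, g₄⟩ := run_addClause hM g₃ false false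
  refine ⟨((b₁.trans b₂).trans b₃).trans b₄, g₄.mono ?_⟩
  rintro ⟨_ | _, i⟩ ⟨_ | _, j⟩ (h | ⟨rfl, rfl⟩) <;> simp_all

theorem run_addClauses {G : SimpleGraph (Fin n)} {A B : Set (Fin n)} {ρ : ℕ → Fin n}
    {M : Fin 8 → Fin n → Fin n → Prop} (hM : IsInput G A B (ρ 0) M) (h : litRel M = Eq) :
    BaseAgree M (addClauses.run 3 ρ M) ∧ litRel (addClauses.run 3 ρ M) =
      Relation.ReflTransGen (Clause G A B (ρ 1) (ρ 2)) := by
  have key : BaseAgree M (addClauses.run 3 ρ M) ∧ Generated (Clause G A B (ρ 1) (ρ 2))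
      (fun p _ => (p.2 : ℕ) < n) (addClauses.run 3 ρ M) := by
    refine iter_induction (fun i M' => BaseAgree M M' ∧ Generated (Clause G A B (ρ 1) (ρ 2))
      (fun p _ => (p.2 : ℕ) < i) M') ⟨.refl M, fun _ _ => False, ?_, by simp, by simp⟩ ?_
    · rw [h]
      ext x y
      constructor
      · rintro rfl
        exact .refl
      · intro h
        induction h with
        | refl => rfl
        | tail _ h _ => exact h.elim
    · rintro i M₁ ⟨b₁, g₁⟩
      have := iter_induction (f := fun j M => (signs addClause).run 5
          (Function.update (Function.update ρ 3 i) 4 j) M) (x := M₁)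
        (fun j M' => BaseAgree M M' ∧ Generated (Clause G A B (ρ 1) (ρ 2))
          (fun p q => (p.2 : ℕ) < i ∨ p.2 = i ∧ (q.2 : ℕ) < j) M')
        ⟨b₁, g₁.mono (by simp)⟩ (by
          rintro j M₂ ⟨b₂, g₂⟩
          obtain ⟨b₃, g₃⟩ := run_signs_addClause
            (ρ := Function.update (Function.update ρ 3 i) 4 j) (b₂.isInput hM) g₂
          refine ⟨b₂.trans b₃, g₃.mono ?_⟩
          rintro p q (h | ⟨h, h'⟩)
          · exact .inl (.inl h)
          · rcases Nat.lt_succ_iff_lt_or_eq.1 h' with h' | h'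
            · exact .inl (.inr ⟨h, h'⟩)
            · exact .inr ⟨by simpa using h, by simpa using Fin.ext h'⟩)
      refine ⟨this.1, this.2.mono fun p q hp => ?_⟩
      rcases Nat.lt_succ_iff_lt_or_eq.1 hp with h' | h'
      · exact .inl h'
      · exact .inr ⟨Fin.ext h', q.2.2⟩
  obtain ⟨hb, r, h₁, h₂, h₃⟩ := key
  refine ⟨hb, ?_⟩
  rw [h₁]
  congr 1
  ext p q
  exact ⟨h₂ p q, fun h => h₃ p q h p.2.2⟩

/-! ### Deciding the variables and reading off a solution -/

/-- Decide every variable that is not yet decided. -/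
def decideAll : Cmd :=
  .all (.ite (.neg (.rel (sym true false) 3 3)) (addEdge 4 false 3 true 3) .skip)

theorem run_decideAll {E : Bool × Fin n → Bool × Fin n → Prop} (ρ : ℕ → Fin n)
    {M : Fin 8 → Fin n → Fin n → Prop} (h : TwoSat.IsClosure E (litRel M)) :
    BaseAgree M (decideAll.run 3 ρ M) ∧ TwoSat.IsClosure E (litRel (decideAll.run 3 ρ M)) ∧
      (TwoSat.Consistent (litRel (decideAll.run 3 ρ M)) ↔ TwoSat.Consistent (litRel M)) ∧
      ∀ v, litRel (decideAll.run 3 ρ M) (true, v) (false, v) ∨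
        litRel (decideAll.run 3 ρ M) (false, v) (true, v) := by
  have key : BaseAgree M (decideAll.run 3 ρ M) ∧ TwoSat.IsClosure E (litRel (decideAll.run 3 ρ M)) ∧
      (TwoSat.Consistent (litRel (decideAll.run 3 ρ M)) ↔ TwoSat.Consistent (litRel M)) ∧
      ∀ v : Fin n, (v : ℕ) < n → litRel (decideAll.run 3 ρ M) (true, v) (false, v) ∨
        litRel (decideAll.run 3 ρ M) (false, v) (true, v) := by
    refine iter_induction (fun i M' => BaseAgree M M' ∧ TwoSat.IsClosure E (litRel M') ∧
      (TwoSat.Consistent (litRel M') ↔ TwoSat.Consistent (litRel M)) ∧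
      ∀ v : Fin n, (v : ℕ) < i → litRel M' (true, v) (false, v) ∨ litRel M' (false, v) (true, v))
      ⟨.refl M, h, .rfl, by simp⟩ ?_
    rintro i M₁ ⟨b₁, h₁, c₁, t₁⟩
    have hF : (Formula.neg (.rel (sym true false) 3 3)).Holds M₁ 4 (Function.update ρ 3 i) ↔
        ¬ litRel M₁ (true, i) (false, i) := by simp [Formula.Holds, litRel]
    simp only [Cmd.run]
    split_ifs with hi
    · replace hi := hF.1 hi
      obtain ⟨b₂, h₂⟩ := run_addEdge false true (show 3 < 4 by omega) (show 3 < 4 by omega)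
        (Function.update ρ 3 i) M₁
      simp only [Function.update_self] at h₂
      refine ⟨b₁.trans b₂, ?_, ?_, ?_⟩
      · rw [h₂]
        exact h₁.insertEdge i
      · rw [h₂, h₁.consistent_insertEdge hi, c₁]
      · intro v hv
        rw [h₂]
        rcases Nat.lt_succ_iff_lt_or_eq.1 hv with h' | h'
        · exact (t₁ v h').imp .inl .inl
        · obtain rfl := Fin.ext h'
          exact .inr (.inr ⟨h₁.refl _, h₁.refl _⟩)
    · replace hi := not_not.1 (mt hF.2 hi)
      refine ⟨b₁, h₁, c₁, fun v hv => ?_⟩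
      rcases Nat.lt_succ_iff_lt_or_eq.1 hv with h' | h'
      · exact t₁ v h'
      · obtain rfl := Fin.ext h'
        exact .inl hi
  exact ⟨key.1, key.2.1, key.2.2.1, fun v => key.2.2.2 v v.2⟩

/-- Write the solution to the symbol `3` if there is one. -/
def output : Cmd :=
  .ite (.ex (.and (.rel (sym true false) 3 3) (.rel (sym false true) 3 3))) .skip
    (.set 3 (.rel (sym false true) 4 4))

/-- Search for a halfspace with a given cut edge. -/
def solve : Cmd := .seq (reset 3) (.seq addClauses (.seq decideAll output))

/-- The rows of the symbol `3` hold a separating set. -/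
def Found (G : SimpleGraph (Fin n)) (A B : Set (Fin n)) (M : Fin 8 → Fin n → Fin n → Prop) :
    Prop :=
  ∃ H, Separates G A B H ∧ H.Nonempty ∧ H ≠ Set.univ ∧ ∀ i j, M 3 i j ↔ j ∈ H

/-- `decideAll` neither creates nor removes inconsistency, so testing afterwards still decides
solvability. That a failed attempt leaves symbol `3` untouched is what lets `search` retain an
earlier success. -/
theorem run_solve {G : SimpleGraph (Fin n)} (hG : G.Connected) {A B : Set (Fin n)} {ρ : ℕ → Fin n}
    {M : Fin 8 → Fin n → Fin n → Prop} (hM : IsInput G A B (ρ 0) M) (hρ : G.Adj (ρ 1) (ρ 2)) :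
    (∀ a, a < 3 → solve.run 3 ρ M a = M a) ∧ (Found G A B (solve.run 3 ρ M) ∨
      solve.run 3 ρ M 3 = M 3 ∧ ¬ ∃ H, Separates G A B H ∧ ρ 1 ∈ H ∧ ρ 2 ∉ H) := by
  simp only [solve, Cmd.run]
  obtain ⟨b₁, h₁⟩ := run_reset 3 ρ M
  obtain ⟨b₂, h₂⟩ := run_addClauses (b₁.isInput hM) h₁
  have hcl := TwoSat.isClosure_reflTransGen (Clause.contra (G := G) (A := A) (B := B)
    (a := ρ 1) (b := ρ 2))
  rw [← h₂] at hcl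
  obtain ⟨b₃, h₃, c₃, t₃⟩ := run_decideAll ρ hcl
  have b := (b₁.trans b₂).trans b₃
  generalize decideAll.run 3 ρ _ = N at b h₃ c₃ t₃ ⊢
  have hcons : (Formula.ex (.and (.rel (sym true false) 3 3) (.rel (sym false true) 3 3))).Holds
      N 3 ρ ↔ ¬ TwoSat.Consistent (litRel N) := by
    simp [Formula.Holds, TwoSat.Consistent, litRel]
  simp only [output, Cmd.run]
  split_ifs with hc
  · refine ⟨fun a ha => b a (ha.trans (by decide)), .inr ⟨b 3 (by decide), ?_⟩⟩
    rintro ⟨H, hH⟩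
    rw [hcons, c₃, h₂] at hc
    exact hc (TwoSat.consistent_of_solution ((separates_iff_clause hG hρ).1 hH))
  · rw [hcons, not_not] at hc
    have hS := (separates_iff_clause hG hρ).2 fun p q => h₃.solution hc t₃
    refine ⟨fun a ha => ?_, .inl ⟨_, hS.1, ⟨_, hS.2.1⟩, ?_, fun i j => ?_⟩⟩
    · rw [Function.update_of_ne (by rintro rfl; exact absurd ha (by decide))]
      exact b a (ha.trans (by decide))
    · exact fun h => hS.2.2 (h ▸ Set.mem_univ _)
    · simp [Formula.Holds, litRel]

/-! ### Search over all cut edges, and the trivial cases -/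

/-- Search for a halfspace with any cut edge. -/
def search : Cmd := .all (.all (.ite (.rel 0 1 2) solve .skip))

theorem run_search {G : SimpleGraph (Fin n)} (hG : G.Connected) {A B : Set (Fin n)} {ρ : ℕ → Fin n}
    {M : Fin 8 → Fin n → Fin n → Prop} (hM : IsInput G A B (ρ 0) M) (h3 : ∀ i j, ¬ M 3 i j) :
    IsInput G A B (ρ 0) (search.run 1 ρ M) ∧ (Found G A B (search.run 1 ρ M) ∨
      (∀ i j, ¬ search.run 1 ρ M 3 i j) ∧
        ¬ ∃ H, Separates G A B H ∧ H.Nonempty ∧ H ≠ Set.univ) := by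
  have key : IsInput G A B (ρ 0) (search.run 1 ρ M) ∧ (Found G A B (search.run 1 ρ M) ∨
      (∀ i j, ¬ search.run 1 ρ M 3 i j) ∧ ∀ a b : Fin n, (a : ℕ) < n → G.Adj a b →
        ¬ ∃ H, Separates G A B H ∧ a ∈ H ∧ b ∉ H) := by
    refine iter_induction (fun i M' => IsInput G A B (ρ 0) M' ∧ (Found G A B M' ∨
      (∀ i j, ¬ M' 3 i j) ∧ ∀ a b : Fin n, (a : ℕ) < i → G.Adj a b →
        ¬ ∃ H, Separates G A B H ∧ a ∈ H ∧ b ∉ H)) ⟨hM, .inr ⟨h3, by simp⟩⟩ ?_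
    rintro i M₁ ⟨m₁, h₁⟩
    have := iter_induction (f := fun j M => (Cmd.ite (.rel 0 1 2) solve .skip).run 3
        (Function.update (Function.update ρ 1 i) 2 j) M) (x := M₁)
      (fun j M' => IsInput G A B (ρ 0) M' ∧ (Found G A B M' ∨
        (∀ i j, ¬ M' 3 i j) ∧ ∀ a b : Fin n, ((a : ℕ) < i ∨ a = i ∧ (b : ℕ) < j) → G.Adj a b →
          ¬ ∃ H, Separates G A B H ∧ a ∈ H ∧ b ∉ H))
      ⟨m₁, by simpa using h₁⟩ (by
        rintro j M₂ ⟨m₂, h₂⟩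
        have hHolds : (Formula.rel 0 1 2).Holds M₂ 3
            (Function.update (Function.update ρ 1 i) 2 j) ↔ G.Adj i j := by
          simp [Formula.Holds, m₂.adj]
        simp only [Cmd.run]
        split_ifs with hij
        · rw [hHolds] at hij
          obtain ⟨a₃, h₃⟩ := run_solve hG (ρ := Function.update (Function.update ρ 1 i) 2 j)
            (M := M₂) (by simpa using m₂) (by simpa using hij)
          refine ⟨m₂.of_agree a₃, ?_⟩
          rcases h₃ with h₃ | ⟨e₃, h₃⟩
          · exact .inl h₃
          -- After a failed attempt, a halfspace found earlier survives in symbol `3`; if there was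
          -- none, one more pair is ruled out.
          · refine h₂.imp ?_ ?_
            · rintro ⟨H, h₄, h₅, h₆, h₇⟩
              exact ⟨H, h₄, h₅, h₆, by rwa [e₃]⟩
            · rintro ⟨h₄, h₅⟩
              refine ⟨by rwa [e₃], ?_⟩
              rintro a b (h | ⟨rfl, h⟩) e
              · exact h₅ a b (.inl h) e
              · rcases Nat.lt_succ_iff_lt_or_eq.1 h with h | h
                · exact h₅ a b (.inr ⟨rfl, h⟩) e
                · obtain rfl := Fin.ext h
                  simpa using h₃
        · rw [hHolds] at hij
          refine ⟨m₂, h₂.imp_right ?_⟩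
          rintro ⟨h₄, h₅⟩
          refine ⟨h₄, ?_⟩
          rintro a b (h | ⟨rfl, h⟩) e
          · exact h₅ a b (.inl h) e
          · rcases Nat.lt_succ_iff_lt_or_eq.1 h with h | h
            · exact h₅ a b (.inr ⟨rfl, h⟩) e
            · obtain rfl := Fin.ext h
              exact absurd e hij)
    refine ⟨this.1, this.2.imp_right (And.imp_right ?_)⟩
    intro h a b ha
    rcases Nat.lt_succ_iff_lt_or_eq.1 ha with h' | h'
    · exact h a b (.inl h')
    · exact h a b (.inr ⟨Fin.ext h', b.2⟩)
  refine ⟨key.1, key.2.imp_right (And.imp_right ?_)⟩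
  rintro h ⟨H, hH, ⟨a, ha⟩, hne⟩
  obtain ⟨b, hb⟩ := (Set.ne_univ_iff_exists_notMem H).1 hne
  -- A nonempty proper halfspace has some cut edge, and that pair has been tried.
  obtain ⟨u, hu, v, hv, huv⟩ := exists_cut_edge hG ha hb
  exact h u v u.2 huv ⟨H, hH, hu, hv⟩

theorem search_closed : search.Closed 1 := by
  refine ⟨by simp [Formula.Closed], ⟨signs_closed fun s t => ?_,
    signs_closed fun s t => ⟨clauseF_closed s t, addEdge_closed s t (by omega) (by omega), trivial⟩,
    ⟨by simp [Formula.Closed], addEdge_closed _ _ (by omega) (by omega), trivial⟩,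
    ⟨by simp [Formula.Closed], trivial, by simp [Cmd.Closed, Formula.Closed]⟩⟩, trivial⟩
  split_ifs <;> simp [Cmd.Closed, Formula.Closed]

/-- Search for a separating halfspace; if `A` or `B` is empty, take the empty set or the set of
all vertices. -/
def separate : Cmd :=
  .seq search (.ite (.ex (.rel 1 0 1)) (.ite (.ex (.rel 2 0 1)) .skip (.set 3 (.eq 1 1)))
    (.set 3 (.neg (.eq 1 1))))

/-- The test whether the search for a separating halfspace was successful. -/
def separateTest : Formula :=
  .or (.ex (.ex (.rel 3 1 2))) (.or (.neg (.ex (.rel 1 0 1))) (.neg (.ex (.rel 2 0 1))))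

theorem separates_empty (G : SimpleGraph (Fin n)) (B : Set (Fin n)) : Separates G ∅ B ∅ :=
  ⟨⟨fun _ h => h.elim, fun _ _ _ _ _ _ => by simp⟩, le_rfl, by simp⟩

theorem separates_univ (G : SimpleGraph (Fin n)) (A : Set (Fin n)) : Separates G A ∅ Set.univ :=
  ⟨⟨fun _ _ _ _ _ _ => trivial, fun _ h => (h trivial).elim⟩, by simp, by simp⟩

theorem run_separate {G : SimpleGraph (Fin n)} (hG : G.Connected) {A B : Set (Fin n)}
    {ρ : ℕ → Fin n} {M : Fin 8 → Fin n → Fin n → Prop} (hM : IsInput G A B (ρ 0) M)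
    (h3 : ∀ i j, ¬ M 3 i j) :
    (separateTest.Holds (separate.run 1 ρ M) 1 ρ ∧
      ∃ H, Separates G A B H ∧ ∀ i j, separate.run 1 ρ M 3 i j ↔ j ∈ H) ∨
    (¬ separateTest.Holds (separate.run 1 ρ M) 1 ρ ∧ ¬ ∃ H, Separates G A B H) := by
  obtain ⟨m, h⟩ := run_search hG hM h3
  simp only [separate, Cmd.run]
  generalize search.run 1 ρ M = N at m h ⊢
  have hA : (Formula.ex (.rel 1 0 1)).Holds N 1 ρ ↔ A.Nonempty := by
    simp [Formula.Holds, m.left, Set.Nonempty]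
  have hB : (Formula.ex (.rel 2 0 1)).Holds N 1 ρ ↔ B.Nonempty := by
    simp [Formula.Holds, m.right, Set.Nonempty]
  by_cases hA' : A.Nonempty
  · by_cases hB' : B.Nonempty
    · rw [if_pos (hA.2 hA'), if_pos (hB.2 hB')]
      rcases h with ⟨H, h₁, ⟨a, ha⟩, -, h₃⟩ | ⟨h₁, h₂⟩
      · refine .inl ⟨?_, H, h₁, h₃⟩
        simp only [separateTest, Formula.Holds]
        -- A halfspace found by the search is nonempty, so nonemptiness of symbol `3` can serve as
        -- the success flag.
        exact .inl ⟨a, a, by simp [h₃, ha]⟩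
      · refine .inr ⟨?_, ?_⟩
        · have h₄ := hA.2 hA'
          have h₅ := hB.2 hB'
          simp only [separateTest, Formula.Holds] at h₄ h₅ ⊢
          simp only [h₁, h₄, h₅, not_true, or_false, not_false_iff, exists_false]
        · rintro ⟨H, hH⟩
          refine h₂ ⟨H, hH, hA'.mono hH.2.1, ?_⟩
          rintro rfl
          obtain ⟨b, hb⟩ := hB'
          exact hH.2.2 hb trivial
    · rw [if_pos (hA.2 hA'), if_neg (mt hB.1 hB')]
      obtain rfl := Set.not_nonempty_iff_eq_empty.1 hB'
      refine .inl ⟨?_, _, separates_univ G A, ?_⟩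
      · simp [separateTest, Formula.Holds, m.right]
      · simp [Formula.Holds]
  · rw [if_neg (mt hA.1 hA')]
    obtain rfl := Set.not_nonempty_iff_eq_empty.1 hA'
    refine .inl ⟨?_, _, separates_empty G B, ?_⟩
    · simp [separateTest, Formula.Holds, m.left]
    · simp [Formula.Holds]

end Monophonic

/-! ### Assembly of the machine programs -/

namespace RAM

/-- Run a command and then test a formula, with the variable `0` standing for the vertex `0`. -/
theorem exists_program (c : Cmd) (φ : Formula) (hc : c.Closed 1) (hφ : φ.Closed 1) :
    ∃ (P : Program) (p : Polynomial ℕ), ∀ (n : ℕ) (ρ : ℕ → Fin n)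
      (M : Fin 8 → Fin n → Fin n → Prop) (s : State), Represents M 1 ρ s →
        ∃ s' t, Exec P s s' t ∧ t ≤ p.eval n ∧ s'.reg 0 = bit (φ.Holds (c.run 1 ρ M) 1 ρ) ∧
          ∀ (a : Fin 8) (i j : Fin n), s'.arr a i j = bit (c.run 1 ρ M a i j) := by
  refine ⟨.seq (c.compile 1) (.seq (φ.compile 1) (.assign 0 (.reg 1))), c.time + (φ.time + 2),
    fun n ρ M s hs => ?_⟩
  obtain ⟨s₁, r₁, h₁, -⟩ := c.compile_runs 1 ρ M s hc hs
  obtain ⟨s₂, r₂, h₂, a₂, -⟩ := φ.compile_runs _ 1 ρ s₁ hφ h₁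
  obtain ⟨t, h, ht⟩ := r₁.seq (r₂.seq (Runs.assign s₂ 0 (.reg 1)))
  refine ⟨_, t, h, by simpa [Expr.cost] using ht, ?_, fun a i j => ?_⟩
  · simpa [Expr.val] using h₂
  · rw [State.setReg_arr, a₂, h₁.arr]

end RAM

theorem mainTheorem3 :
    (∃ (P : RAM.Program) (p : Polynomial ℕ),
      ∀ (n : ℕ) (G : SimpleGraph (Fin n)), G.Connected → ∀ A B : Set (Fin n),
        ∃ (s : RAM.State) (t : ℕ),
          RAM.Exec P (RAM.graphSetsInput G A B) s t ∧ t ≤ p.eval n ∧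
          ((s.accepts ∧ ∃ H : Set (Fin n), s.outputs H ∧ Monophonic.Separates G A B H) ∨
            (s.rejects ∧ ¬ ∃ H : Set (Fin n), Monophonic.Separates G A B H))) ∧
    (∃ (Q : RAM.Program) (q : Polynomial ℕ),
      ∀ (n : ℕ) (G : SimpleGraph (Fin n)), G.Connected →
        ∃ (s : RAM.State) (t : ℕ),
          RAM.Exec Q (RAM.graphInput G) s t ∧ t ≤ q.eval n ∧
          ((s.accepts ∧ ∃ H ∈ Monophonic.halfspaces G, ∅ ⊂ H ∧ H ⊂ Set.univ) ∨
            (s.rejects ∧ ¬ ∃ H ∈ Monophonic.halfspaces G, ∅ ⊂ H ∧ H ⊂ Set.univ))) := by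
  constructor
  · obtain ⟨P, p, h⟩ := RAM.exists_program Monophonic.separate Monophonic.separateTest
      ⟨Monophonic.search_closed, by simp [RAM.Cmd.Closed, RAM.Formula.Closed]⟩
      (by simp [Monophonic.separateTest, RAM.Formula.Closed])
    refine ⟨P, p, fun n G hG A B => ?_⟩
    obtain ⟨v⟩ := hG.nonempty
    -- Connectedness supplies a vertex, so vertex `0` exists. As the value of variable `0` it lets
    -- formulas address row `0`, where the input sets are stored.
    let z : Fin n := ⟨0, by have := v.2; omega⟩
    let M : Fin 8 → Fin n → Fin n → Prop := fun a i j =>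
      if a = 0 then G.Adj i j else if a = 1 then i = z ∧ j ∈ A else if a = 2 then i = z ∧ j ∈ B
      else False
    obtain ⟨s, t, he, ht, hr, ha⟩ := h n (fun _ => z) M (RAM.graphSetsInput G A B)
      ⟨by simp [RAM.graphSetsInput, RAM.graphInput],
        fun i hi => by simp [RAM.graphSetsInput, RAM.graphInput, z],
        fun a i j => by
          have h0 : (i : ℕ) = 0 ↔ i = z := by simp [z, Fin.ext_iff]
          fin_cases a <;> simp [RAM.graphSetsInput, RAM.graphInput, M, RAM.bit_of_false] <;>
            exact RAM.bit_congr (by simp [Fin.val_inj, h0])⟩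
    refine ⟨s, t, he, ht, ?_⟩
    rcases Monophonic.run_separate hG (A := A) (B := B) (ρ := fun _ => z) (M := M)
      ⟨by simp [M], by simp [M], by simp [M]⟩ (by simp [M]) with ⟨h₁, H, h₂, h₃⟩ | ⟨h₁, h₂⟩
    · refine .inl ⟨hr.trans (RAM.bit_of_true h₁), H, fun j => ?_, h₂⟩
      exact (ha 3 z j).trans (RAM.bit_congr (h₃ z j))
    · exact .inr ⟨hr.trans (RAM.bit_of_false h₁), h₂⟩
  · obtain ⟨P, p, h⟩ := RAM.exists_program Monophonic.search (.ex (.ex (.rel 3 1 2)))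
      Monophonic.search_closed (by simp [RAM.Formula.Closed])
    refine ⟨P, p, fun n G hG => ?_⟩
    obtain ⟨v⟩ := hG.nonempty
    let z : Fin n := ⟨0, by have := v.2; omega⟩
    let M : Fin 8 → Fin n → Fin n → Prop := fun a i j => if a = 0 then G.Adj i j else False
    obtain ⟨s, t, he, ht, hr, -⟩ := h n (fun _ => z) M (RAM.graphInput G)
      ⟨by simp [RAM.graphInput], fun i hi => by simp [RAM.graphInput, z],
        fun a i j => by
          fin_cases a <;> simp [RAM.graphInput, M, RAM.bit_of_false]
          exact RAM.bit_congr (by simp [Fin.val_inj])⟩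
    refine ⟨s, t, he, ht, ?_⟩
    -- With both sets empty, separation imposes nothing beyond being a halfspace, and the search
    -- looks only for nonempty proper ones.
    rcases (Monophonic.run_search hG (A := ∅) (B := ∅) (ρ := fun _ => z) (M := M)
      ⟨by simp [M], by simp [M], by simp [M]⟩ (by simp [M])).2 with
        ⟨H, h₁, ⟨w, hw⟩, h₂, h₃⟩ | ⟨h₁, h₂⟩
    · refine .inl ⟨hr.trans (RAM.bit_of_true ⟨w, w, ?_⟩), H, h₁.1,
        Set.empty_ssubset.2 ⟨w, hw⟩, Set.ssubset_univ_iff.2 h₂⟩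
      simp [RAM.Formula.Holds, h₃, hw]
    · refine .inr ⟨hr.trans (RAM.bit_of_false ?_), ?_⟩
      · rintro ⟨i, j, h⟩
        exact h₁ _ _ h
      · rintro ⟨H, h₄, h₅, h₆⟩
        exact h₂ ⟨H, ⟨h₄, by simp, by simp⟩, Set.empty_ssubset.1 h₅, Set.ssubset_univ_iff.1 h₆⟩
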